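/- **Setting.** Let $R$ be a commutative $\mathbb C$-algebra (for instance $\mathbb C$, or a ring of polynomials in formal variables) and let $(c_i),(d_i),(e_i)_{i\in\mathbb Z}$ be families in $R$. For $\gamma\in\mathbb Z$ put $C^{(\gamma)}(z)=\sum_{i\in\mathbb Z}c_{i+\gamma}z^{-i-1}$, and define $D^{(\gamma)}$, $E^{(\gamma)}$ in the same way from $(d_i)$, $(e_i)$. *Fock space.* Let $F$ be the three-component fermionic Fock space over $R$. Its basis consists of the elementary wedges $w_0\wedge w_1\wedge\cdots$ in the vectors $e_az^j$ ($a=0,1,2$, $j\in\mathbb Z$), taken in increasing order for $\dots,e_0,e_1,e_2,e_0z,e_1z,e_2z,\dots$, whose sets of factors differ by finitely many elements from that of the vacuum $v_0=e_0\wedge e_1\wedge e_2\wedge e_0z\wedge e_1z\wedge e_2z\wedge\cdots$. Let $\langle\cdot,\cdot\rangle$ be the bilinear form for which the elementary wedges are orthonormal; it also pairs formal infinite combinations of elementary wedges with elements of $F$. Let ${}_a\psi^+_{(k)}$ be the exterior product with $e_az^k$, let ${}_a\psi^-_{(k)}$ be the interior product with $e_az^{-k-1}$, put $\psi_a^\pm(w)=\sum_k{}_a\psi^\pm_{(k)}w^{-k-1}$,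 and let $E_{ab}(w)=\psi_a^+(w)\psi_b^-(w)$ for $a\neq b$. *Translation operators.* Let $Q_a$ ($a=0,1,2$) be the invertible linear operators on $F$ determined by $Q_av_0={}_a\psi^+_{(-1)}v_0$, $\;Q_a\,{}_a\psi^\pm_{(k)}={}_a\psi^\pm_{(k\mp1)}Q_a$ and $Q_a\,{}_b\psi^\pm_{(k)}=-{}_b\psi^\pm_{(k)}Q_a$ for $b\ne a$. Put $T_1=Q_1Q_0^{-1}$ and $T_2=Q_2Q_1^{-1}$. *Tau-functions.* Let $$g^{(\alpha,\beta)}=\exp\bigl(\operatorname{Res}_wC^{(\alpha-\beta)}(w)E_{10}(w)\bigr)\exp\bigl(\operatorname{Res}_wD^{(\alpha)}(w)E_{20}(w)\bigr)\exp\bigl(\operatorname{Res}_wE^{(\beta)}(w)E_{21}(w)\bigr),$$ which lies over the loop matrix $\begin{bmatrix}1&0&0\\C^{(\alpha-\beta)}&1&0\\D^{(\alpha)}&E^{(\beta)}&1\end{bmatrix}$, and put $$\tau_{k,\ell}^{(\alpha,\beta)}=\langle g^{(\alpha,\beta)}v_0,\;T_1^kT_2^\ell v_0\rangle\qquad(k,\ell,\alpha,\beta\in\mathbb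 Z).$$ When $E^{(\beta)}=0$, every sum in this definition is finite. **Statement.** Let $\alpha,\beta\in\mathbb Z$ and suppose that $E^{(\beta)}(z)=0$. 1. $\tau_{k,\ell}^{(\alpha,\beta)}=0$ for all integers $k<\ell$. 2. For all integers $k\ge\ell\ge0$, $$\tau_{k,\ell}^{(\alpha,\beta)}=(-1)^{\frac{\ell(\ell+1)}2}\det\begin{bmatrix}d_\alpha&\cdots&d_{\alpha+\ell-1}&c_{\alpha-\beta}&\cdots&c_{\alpha-\beta+k-\ell-1}\\ d_{\alpha+1}&\cdots&d_{\alpha+\ell}&c_{\alpha-\beta+1}&\cdots&c_{\alpha-\beta+k-\ell}\\ \vdots&&\vdots&\vdots&&\vdots\\ d_{\alpha+k-1}&\cdots&d_{\alpha+k+\ell-2}&c_{\alpha-\beta+k-1}&\cdots&c_{\alpha-\beta+2k-\ell-2}\end{bmatrix}$$ (a $k\times k$ determinant; it is $1$ when $k=0$). 3. Let the $c_i$ and $d_i$ be formal variables. Let $S_c^+(z)$ and $S_d^+(z)$ be the $\mathbb C[z,z^{-1}]$-algebra endomorphisms of the polynomial ring over $\mathbb C[z,z^{-1}]$ in these variables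 such that $S_c^+(z)c_i=c_i-c_{i+1}/z$, $S_c^+(z)d_i=d_i$, and $S_d^+(z)d_i=d_i-d_{i+1}/z$, $S_d^+(z)c_i=c_i$. Then for all integers $k\ge\ell\ge0$, $$z^kS_c^+(z)S_d^+(z)\,\tau_{k,\ell}^{(\alpha,\beta)}=(-1)^{\frac{\ell(\ell+1)}2}\det\begin{bmatrix}d_\alpha&\cdots&d_{\alpha+\ell-1}&c_{\alpha-\beta}&\cdots&c_{\alpha-\beta+k-\ell-1}&1\\ d_{\alpha+1}&\cdots&d_{\alpha+\ell}&c_{\alpha-\beta+1}&\cdots&c_{\alpha-\beta+k-\ell}&z\\ \vdots&&\vdots&\vdots&&\vdots&\vdots\\ d_{\alpha+k}&\cdots&d_{\alpha+k+\ell-1}&c_{\alpha-\beta+k}&\cdots&c_{\alpha-\beta+2k-\ell-1}&z^k\end{bmatrix}.$$ -/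

import Mathlib

open scoped LaurentPolynomial

noncomputable section

namespace FermionicFock

/-! ### Three-component fermionic Fock space -/

/-- The mode `(a, j)` stands for the basis vector `e_a z^j` of `ℂ³ ⊗ ℂ[z, z⁻¹]`, `a = 0, 1, 2`. -/
abbrev Mode : Type := Fin 3 × ℤ

/-- The place of `e_a z^j` in the ordering
`…, e₀, e₁, e₂, e₀ z, e₁ z, e₂ z, e₀ z², …` of the basis. -/
def place (b : Mode) : ℤ := 3 * b.2 + (b.1.val : ℤ)

/-- The modes occurring in the vacuum vector `e₀ ∧ e₁ ∧ e₂ ∧ e₀ z ∧ e₁ z ∧ e₂ z ∧ ⋯`. -/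
def sea : Set Mode := {b | 0 ≤ b.2}

/-- An elementary wedge `w₀ ∧ w₁ ∧ w₂ ∧ ⋯` (basis vectors in increasing order), recorded by the
set of its modes, which differs from that of the vacuum by finitely many modes. -/
@[ext] structure Wedge where
  modes : Set Mode
  finite_diff : (symmDiff modes sea).Finite

/-- Add the mode `b`. -/
def Wedge.add (S : Wedge) (b : Mode) : Wedge where
  modes := insert b S.modes
  finite_diff := by
    refine (S.finite_diff.union (Set.finite_singleton b)).subset ?_
    intro x hx
    simp only [Set.mem_symmDiff, Set.mem_insert_iff, Set.mem_union, Set.mem_singleton_iff] at hx ⊢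
    tauto

/-- Take away the mode `b`. -/
def Wedge.del (S : Wedge) (b : Mode) : Wedge where
  modes := S.modes \ {b}
  finite_diff := by
    refine (S.finite_diff.union (Set.finite_singleton b)).subset ?_
    intro x hx
    simp only [Set.mem_symmDiff, Set.mem_sdiff, Set.mem_union, Set.mem_singleton_iff] at hx ⊢
    tauto

/-- The modes of `S` that come before `b`. -/
def Wedge.earlier (S : Wedge) (b : Mode) : Set Mode := {s ∈ S.modes | place s < place b}

theorem Wedge.finite_earlier (S : Wedge) (b : Mode) : (S.earlier b).Finite := by
  have h : ({s : Mode | 0 ≤ s.2 ∧ s.2 ≤ b.2} : Set Mode).Finite := by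
    refine ((Set.finite_univ (α := Fin 3)).prod (Set.finite_Icc (0 : ℤ) b.2)).subset ?_
    rintro ⟨a, j⟩ hj
    simpa using hj
  refine (S.finite_diff.union h).subset ?_
  rintro ⟨a, j⟩ ⟨hs, hlt⟩
  simp only [place] at hlt
  simp only [Set.mem_union, Set.mem_symmDiff, sea, Set.mem_ofPred_eq]
  by_cases h0 : 0 ≤ j
  · right
    exact ⟨h0, by omega⟩
  · left
    exact Or.inl ⟨hs, h0⟩

/-- The sign `(-1)^m`, where `m` is the number of factors of `S` that `e_b` has to pass. -/
def Wedge.sign (S : Wedge) (b : Mode) : ℤˣ := (-1) ^ (S.earlier b).ncard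

variable (R : Type*) [CommRing R]

/-- Formal, possibly infinite, `R`-linear combinations of elementary wedges: the completion of
the fermionic Fock space, in which the vector `g · v₀` lives. -/
abbrev Fock : Type _ := Wedge → R

/-- The vacuum as an elementary wedge. -/
def vac : Wedge where
  modes := sea
  finite_diff := by simp

open Classical in
/-- The elementary wedge `S` as a vector. -/
def wedge (S : Wedge) : Fock R := Pi.single S 1

/-- The vacuum vector `v₀`. -/
def v₀ : Fock R := wedge R vac

variable {R}

open Classical in
/-- The exterior product operator `w ↦ e_b ∧ w`. -/
def exteriorOp (b : Mode) (φ : Fock R) : Fock R :=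
  fun S => if b ∈ S.modes then ((S.sign b : ℤ) : R) * φ (S.del b) else 0

open Classical in
/-- The interior product operator: `e_b ∧ w ↦ w`, and `w ↦ 0` if `e_b` does not occur in `w`. -/
def interiorOp (b : Mode) (φ : Fock R) : Fock R :=
  fun S => if b ∈ S.modes then 0 else ((S.sign b : ℤ) : R) * φ (S.add b)

/-- The bilinear form for which the elementary wedges are orthonormal. -/
def pairing (φ ψ : Fock R) : R := ∑ᶠ S : Wedge, φ S * ψ S

/-- The coefficient of `w^(-k-1)` in the fermion field `ψ_a⁺(w)`. -/
def psiPlus (a : Fin 3) (k : ℤ) : Fock R → Fock R := exteriorOp (a, k)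

/-- The coefficient of `w^(-k-1)` in the fermion field `ψ_a⁻(w)`. -/
def psiMinus (a : Fin 3) (k : ℤ) : Fock R → Fock R := interiorOp (a, -k - 1)

/-! ### The action of the lower unipotent loop group -/

/-- The action of `E_ab z^m`, `a ≠ b`: the coefficient of `w^(-m-1)` in
`E_ab(w) = ψ_a⁺(w) ψ_b⁻(w)`. -/
def current (a b : Fin 3) (m : ℤ) (φ : Fock R) : Fock R :=
  fun S => ∑ᶠ q : ℤ, psiPlus a (m - 1 - q) (psiMinus b q φ) S

/-- The action of `f(z) E_ab`, that is of `Res_w (f(w) E_ab(w))`, for the formal series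
`f(z) = ∑ i, f_i / z^(i+1)`. -/
def loopAction (a b : Fin 3) (f : ℤ → R) (φ : Fock R) : Fock R :=
  fun S => ∑ᶠ i : ℤ, f i * current a b (-i - 1) φ S

/-- The action of `exp (f(z) E_ab)`. -/
def expAction [Algebra ℂ R] (a b : Fin 3) (f : ℤ → R) (φ : Fock R) : Fock R :=
  fun S => ∑ᶠ n : ℕ, ((n.factorial : ℂ)⁻¹) • ((loopAction a b f)^[n] φ) S

/-- The action of the group element over the loop matrix
`[[1, 0, 0], [C, 1, 0], [D, E, 1]] = exp (C E₁₀) exp (D E₂₀) exp (E E₂₁)`. -/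
def groupAction [Algebra ℂ R] (C D E : ℤ → R) (φ : Fock R) : Fock R :=
  expAction 1 0 C (expAction 2 0 D (expAction 2 1 E φ))

/-! ### Fermionic translation operators -/

/-- Replace every mode `(a, j)` of component `a` by `(a, j - n)`. -/
def Wedge.translate (a : Fin 3) (n : ℤ) (S : Wedge) : Wedge where
  modes := {b | (b.1, if b.1 = a then b.2 + n else b.2) ∈ S.modes}
  finite_diff := by
    have h1 : ({b : Mode | (b.1, if b.1 = a then b.2 + n else b.2) ∈
        symmDiff S.modes sea}).Finite := by
      refine S.finite_diff.preimage (f := fun b : Mode =>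
        ((b.1, if b.1 = a then b.2 + n else b.2) : Mode)) ?_
      rintro ⟨x, i⟩ - ⟨y, j⟩ - h
      simp only [Prod.mk.injEq] at h
      obtain ⟨rfl, h⟩ := h
      split_ifs at h <;> simp_all
    have h2 : ((Set.univ : Set (Fin 3)) ×ˢ Set.Icc (-|n|) |n|).Finite :=
      Set.finite_univ.prod (Set.finite_Icc _ _)
    refine (h1.union h2).subset ?_
    rintro ⟨x, i⟩ hx
    simp only [Set.mem_symmDiff, sea, Set.mem_ofPred_eq, Set.mem_union, Set.mem_prod, Set.mem_univ,
      true_and, Set.mem_Icc] at hx ⊢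
    have e1 := neg_abs_le n
    have e2 := le_abs_self n
    have e3 := abs_nonneg n
    split_ifs at hx ⊢ <;> by_cases h0 : (-|n| ≤ i ∧ i ≤ |n|) <;>
      first
        | exact Or.inr h0
        | (left
           rcases hx with ⟨p, q⟩ | ⟨p, q⟩
           · exact Or.inl ⟨p, by omega⟩
           · exact Or.inr ⟨by omega, q⟩)

theorem Wedge.translate_translate (a : Fin 3) (m n : ℤ) (h : m + n = 0) (S : Wedge) :
    (S.translate a m).translate a n = S := by
  ext ⟨x, i⟩
  simp only [Wedge.translate, Set.mem_ofPred_eq]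
  by_cases hx : x = a
  · simp only [hx, if_true]
    rw [show i + n + m = i by omega]
  · simp [hx]

/-- The modes `e_c z^j` of `S`, `c ≠ a`, for which the mode of component `a` that comes to pass
`e_c z^j` when component `a` is multiplied by `z⁻¹` is missing in `S`. -/
def Wedge.crossings (a : Fin 3) (S : Wedge) : Set Mode :=
  {b ∈ S.modes | b.1 ≠ a ∧ (a, if b.1 < a then b.2 else b.2 + 1) ∉ S.modes}

/-- The sign of the translation operator `Q_a` on the elementary wedge `S`. -/
def Wedge.translationSign (a : Fin 3) (S : Wedge) : ℤˣ := (-1) ^ (S.crossings a).ncard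

theorem Wedge.finite_crossings (a : Fin 3) (S : Wedge) : (S.crossings a).Finite := by
  have h := (S.finite_diff.image fun b : Mode => b.2)
  have h2 : ((Set.univ : Set (Fin 3)) ×ˢ ((fun b : Mode => b.2) '' symmDiff S.modes sea ∪
      (fun j : ℤ => j - 1) '' ((fun b : Mode => b.2) '' symmDiff S.modes sea))).Finite :=
    Set.finite_univ.prod (h.union (h.image _))
  refine h2.subset ?_
  rintro ⟨c, j⟩ ⟨hS, hc, hn⟩
  simp only [Set.mem_prod, Set.mem_univ, true_and, Set.mem_union, Set.mem_image]
  by_cases h0 : 0 ≤ j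
  · split_ifs at hn with hlt
    · exact Or.inl ⟨(a, j), Or.inr ⟨h0, hn⟩, rfl⟩
    · exact Or.inr ⟨j + 1, ⟨(a, j + 1), Or.inr ⟨by simp [sea]; omega, hn⟩, rfl⟩, by simp⟩
  · exact Or.inl ⟨(c, j), Or.inl ⟨hS, h0⟩, rfl⟩

theorem Wedge.ncard_earlier_translate (a : Fin 3) (S : Wedge) (b : Mode) :
    ((S.translate a 1).earlier b).ncard =
      ({s ∈ S.modes | place (s.1, if s.1 = a then s.2 - 1 else s.2) < place b}).ncard := by
  refine Set.ncard_congr (fun s _ => (s.1, if s.1 = a then s.2 + 1 else s.2)) ?_ ?_ ?_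
  · rintro ⟨c, j⟩ ⟨h1, h2⟩
    refine ⟨h1, ?_⟩
    by_cases hc : c = a <;> simpa [hc] using h2
  · rintro ⟨c, j⟩ ⟨c', j'⟩ - - h
    simp only [Prod.mk.injEq] at h
    obtain ⟨rfl, h⟩ := h
    by_cases hc : c = a <;> simp_all
  · rintro ⟨c, j⟩ ⟨h1, h2⟩
    refine ⟨(c, if c = a then j - 1 else j), ⟨?_, h2⟩, ?_⟩
    · by_cases hc : c = a <;> simp_all [Wedge.translate]
    · by_cases hc : c = a <;> simp_all

theorem Wedge.sign_self (a : Fin 3) (k : ℤ) (S : Wedge) (hk : (a, k) ∈ S.modes) :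
    S.translationSign a * S.sign (a, k) =
      (S.translate a 1).sign (a, k - 1) * (S.del (a, k)).translationSign a := by
  have hE := S.finite_earlier (a, k)
  set X : Set Mode := {b ∈ S.modes | b.1 ≠ a ∧ k = if b.1 < a then b.2 else b.2 + 1} with hX
  have hXE : X ⊆ S.earlier (a, k) := by
    rintro ⟨c, j⟩ ⟨h1, h2, h3⟩
    refine ⟨h1, ?_⟩
    simp only [place]
    simp only at h3
    simp only [ne_eq, Fin.ext_iff] at h2
    split_ifs at h3 with h <;> simp only [Fin.lt_def] at h <;> omega
  have hXf := hE.subset hXE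
  have h1 : ((S.translate a 1).earlier (a, k - 1)).ncard + X.ncard =
      (S.earlier (a, k)).ncard := by
    rw [Wedge.ncard_earlier_translate, ← Set.ncard_sdiff_add_ncard_of_subset hXE hE]
    congr 2
    ext ⟨c, j⟩
    simp only [hX, Wedge.earlier, place, Set.mem_sdiff, Set.mem_ofPred_eq, Fin.ext_iff,
      Fin.lt_def, ne_eq]
    by_cases hs : (c, j) ∈ S.modes
    · simp only [hs, true_and]
      split_ifs <;> omega
    · simp [hs]
  have h2 : (S.crossings a).ncard + X.ncard = ((S.del (a, k)).crossings a).ncard := by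
    rw [← Set.ncard_union_eq _ (S.finite_crossings a) hXf]
    · congr 1
      ext ⟨c, j⟩
      simp only [hX, Wedge.crossings, Wedge.del, Set.mem_union, Set.mem_sdiff,
        Set.mem_ofPred_eq, Set.mem_singleton_iff, Prod.mk.injEq, ne_eq, not_and, true_and]
      by_cases hc : c = a
      · simp [hc]
      · by_cases hj : (if c < a then j else j + 1) = k
        · simp [hc, hj, hk]
        · simp [hc, hj, Ne.symm hj]
    · rw [Set.disjoint_left]
      rintro ⟨c, j⟩ ⟨-, -, h⟩ ⟨-, -, h'⟩
      exact h (h' ▸ hk)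
  simp only [Wedge.translationSign, Wedge.sign, ← h1, ← h2, pow_add]
  exact mul_left_comm _ _ _

theorem Wedge.sign_ne (a : Fin 3) (b : Mode) (hb : b.1 ≠ a) (S : Wedge) (hS : b ∈ S.modes) :
    S.translationSign a * S.sign b =
      -((S.translate a 1).sign b * (S.del b).translationSign a) := by
  obtain ⟨c, m⟩ := b
  simp only at hb
  have hE := S.finite_earlier (c, m)
  set m' : ℤ := if c < a then m else m + 1 with hm'
  have hc1 : ((S.del (c, m)).crossings a) = S.crossings a \ {(c, m)} := by
    ext ⟨x, j⟩
    simp only [Wedge.crossings, Wedge.del, Set.mem_sdiff, Set.mem_ofPred_eq,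
      Set.mem_singleton_iff, Prod.mk.injEq, Ne.symm hb, false_and, not_false_eq_true, and_true]
    tauto
  have hlt : ∀ x : Fin 3, x = a → ∀ j : ℤ,
      (3 * (j - 1) + (x.val : ℤ) < 3 * m + c.val ↔ j ≤ m') ∧
      (3 * j + (x.val : ℤ) < 3 * m + c.val ↔ j < m') := by
    rintro x rfl j
    have : c.val ≠ x.val := fun h => hb (Fin.ext h)
    rw [hm']
    split_ifs with h <;> simp only [Fin.lt_def] at h <;> omega
  by_cases hk : (a, m') ∈ S.modes
  · have h1 : (S.crossings a \ {(c, m)}) = S.crossings a := by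
      refine Set.sdiff_singleton_eq_self ?_
      rintro ⟨-, -, h⟩
      exact h hk
    have h2 : ((S.translate a 1).earlier (c, m)).ncard = (S.earlier (c, m)).ncard + 1 := by
      rw [Wedge.ncard_earlier_translate, ← Set.ncard_insert_of_notMem (a := (a, m')) _ hE]
      · congr 1
        ext ⟨x, j⟩
        simp only [Wedge.earlier, place, Set.mem_insert_iff, Set.mem_ofPred_eq, Prod.mk.injEq]
        by_cases hx : x = a
        · simp only [hx, if_true, (hlt a rfl j).1, (hlt a rfl j).2, true_and]
          constructor
          · rintro ⟨p, q⟩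
            rcases q.eq_or_lt with q | q
            · exact Or.inl q
            · exact Or.inr ⟨p, q⟩
          · rintro (q | ⟨p, q⟩)
            · exact ⟨q ▸ hk, q.le⟩
            · exact ⟨p, q.le⟩
        · simp [hx]
      · rintro ⟨-, h⟩
        exact lt_irrefl _ ((hlt a rfl m').2.1 h)
    simp only [Wedge.translationSign, Wedge.sign, hc1, h1, h2, pow_succ]
    rw [mul_comm]
    simp
  · have h1 : (S.crossings a \ {(c, m)}).ncard + 1 = (S.crossings a).ncard :=
      Set.ncard_sdiff_singleton_add_one ⟨hS, hb, hk⟩ (S.finite_crossings a)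
    have h2 : ((S.translate a 1).earlier (c, m)).ncard = (S.earlier (c, m)).ncard := by
      rw [Wedge.ncard_earlier_translate]
      congr 1
      ext ⟨x, j⟩
      simp only [Wedge.earlier, place, Set.mem_ofPred_eq]
      by_cases hx : x = a
      · simp only [hx, if_true, (hlt a rfl j).1, (hlt a rfl j).2]
        refine and_congr_right fun p => ⟨fun q => ?_, le_of_lt⟩
        rcases q.eq_or_lt with q | q
        · exact absurd (q ▸ p) hk
        · exact q
      · simp [hx]
    simp only [Wedge.translationSign, Wedge.sign, hc1, ← h1, h2, pow_succ]
    rw [mul_comm]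
    simp

theorem Wedge.add_del (S : Wedge) (b : Mode) (h : b ∉ S.modes) : (S.add b).del b = S := by
  ext x
  simp only [Wedge.add, Wedge.del, Set.mem_sdiff, Set.mem_insert_iff, Set.mem_singleton_iff]
  by_cases hx : x = b <;> simp_all

theorem Wedge.earlier_add (S : Wedge) (b : Mode) : (S.add b).earlier b = S.earlier b := by
  ext x
  simp only [Wedge.add, Wedge.earlier, Set.mem_ofPred_eq, Set.mem_insert_iff]
  refine ⟨?_, fun h => ⟨Or.inr h.1, h.2⟩⟩
  rintro ⟨rfl | h, h'⟩
  · exact absurd h' (lt_irrefl _)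
  · exact ⟨h, h'⟩

theorem Wedge.translate_del_self (a : Fin 3) (n j : ℤ) (S : Wedge) :
    (S.del (a, j)).translate a n = (S.translate a n).del (a, j - n) := by
  ext ⟨x, i⟩
  by_cases hx : x = a
  · simp [Wedge.translate, Wedge.del, hx, eq_sub_iff_add_eq]
  · simp [Wedge.translate, Wedge.del, hx]

theorem Wedge.translate_add_self (a : Fin 3) (n j : ℤ) (S : Wedge) :
    (S.add (a, j)).translate a n = (S.translate a n).add (a, j - n) := by
  ext ⟨x, i⟩
  by_cases hx : x = a
  · simp [Wedge.translate, Wedge.add, hx, eq_sub_iff_add_eq]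
  · simp [Wedge.translate, Wedge.add, hx]

theorem Wedge.translate_del_ne (a : Fin 3) (n : ℤ) (b : Mode) (hb : b.1 ≠ a) (S : Wedge) :
    (S.del b).translate a n = (S.translate a n).del b := by
  obtain ⟨c, j⟩ := b
  ext ⟨x, i⟩
  by_cases hx : x = a
  · have : a ≠ c := fun h => hb h.symm
    simp [Wedge.translate, Wedge.del, hx, this]
  · simp [Wedge.translate, Wedge.del, hx]

theorem Wedge.translate_add_ne (a : Fin 3) (n : ℤ) (b : Mode) (hb : b.1 ≠ a) (S : Wedge) :
    (S.add b).translate a n = (S.translate a n).add b := by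
  obtain ⟨c, j⟩ := b
  ext ⟨x, i⟩
  by_cases hx : x = a
  · have : a ≠ c := fun h => hb h.symm
    simp [Wedge.translate, Wedge.add, hx, this]
  · simp [Wedge.translate, Wedge.add, hx]

variable (R)

/-- The fermionic translation operator `Q_a`, which multiplies component `a` by `z⁻¹`. Its sign
on elementary wedges is the one for which `Q_a v₀ = ψ⁺_{a,(-1)} v₀`,
`Q_a ψ_{a,(k)}^± = ψ_{a,(k ∓ 1)}^± Q_a` and `Q_a ψ_{b,(k)}^± = - ψ_{b,(k)}^± Q_a` for `b ≠ a`,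
see `Q_vacuum`, `Q_psiPlus_self`, `Q_psiMinus_self`, `Q_psiPlus_ne` and `Q_psiMinus_ne`. -/
def Q (a : Fin 3) : Fock R ≃ₗ[R] Fock R where
  toFun φ S := (((S.translate a (-1)).translationSign a : ℤ) : R) * φ (S.translate a (-1))
  invFun φ S := ((S.translationSign a : ℤ) : R) * φ (S.translate a 1)
  map_add' φ ψ := by
    funext S
    simp [mul_add]
  map_smul' r φ := by
    funext S
    simp [mul_left_comm]
  left_inv φ := by
    funext S
    simp only [Wedge.translate_translate a 1 (-1) (by norm_num)]
    rw [← mul_assoc, ← Int.cast_mul, Int.units_coe_mul_self, Int.cast_one, one_mul]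
  right_inv φ := by
    funext S
    simp only [Wedge.translate_translate a (-1) 1 (by norm_num)]
    rw [← mul_assoc, ← Int.cast_mul, Int.units_coe_mul_self, Int.cast_one, one_mul]

theorem Q_apply (a : Fin 3) (φ : Fock R) (S : Wedge) : Q R a φ S =
    (((S.translate a (-1)).translationSign a : ℤ) : R) * φ (S.translate a (-1)) := rfl

theorem Q_psiPlus_self (a : Fin 3) (k : ℤ) (φ : Fock R) :
    Q R a (psiPlus a k φ) = psiPlus a (k - 1) (Q R a φ) := by
  funext S
  obtain ⟨S, rfl⟩ : ∃ S' : Wedge, S = S'.translate a 1 :=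
    ⟨S.translate a (-1), (Wedge.translate_translate a (-1) 1 (by norm_num) S).symm⟩
  have hm : (a, k - 1) ∈ (S.translate a 1).modes ↔ (a, k) ∈ S.modes := by
    simp [Wedge.translate]
  have ht := Wedge.translate_translate a 1 (-1) (by norm_num) S
  have hd : ((S.translate a 1).del (a, k - 1)).translate a (-1) = S.del (a, k) := by
    rw [Wedge.translate_del_self, ht]
    simp
  by_cases h : (a, k) ∈ S.modes
  · simp only [Q_apply, psiPlus, exteriorOp, ht, hd, h, hm.2 h, if_true]
    simp only [← mul_assoc, ← Int.cast_mul, ← Units.val_mul, Wedge.sign_self a k S h]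
  · simp [Q_apply, psiPlus, exteriorOp, ht, h, hm]

theorem Q_psiMinus_self (a : Fin 3) (k : ℤ) (φ : Fock R) :
    Q R a (psiMinus a k φ) = psiMinus a (k + 1) (Q R a φ) := by
  funext S
  obtain ⟨S, rfl⟩ : ∃ S' : Wedge, S = S'.translate a 1 :=
    ⟨S.translate a (-1), (Wedge.translate_translate a (-1) 1 (by norm_num) S).symm⟩
  have hk : -(k + 1) - 1 = -k - 1 - 1 := by ring
  have hm : (a, -k - 1 - 1) ∈ (S.translate a 1).modes ↔ (a, -k - 1) ∈ S.modes := by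
    simp [Wedge.translate]
  have ht := Wedge.translate_translate a 1 (-1) (by norm_num) S
  have hd : ((S.translate a 1).add (a, -k - 1 - 1)).translate a (-1) = S.add (a, -k - 1) := by
    rw [Wedge.translate_add_self, ht]
    simp
  by_cases h : (a, -k - 1) ∈ S.modes
  · simp only [Q_apply, psiMinus, interiorOp, hk, ht, h, hm.2 h, if_true, mul_zero]
  · have hs := Wedge.sign_self a (-k - 1) (S.add (a, -k - 1)) (Set.mem_insert _ _)
    rw [Wedge.add_del S _ h, Wedge.translate_add_self, Wedge.sign, Wedge.sign,
      Wedge.earlier_add, Wedge.earlier_add, ← Wedge.sign, ← Wedge.sign] at hs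
    have hs' : S.translationSign a * S.sign (a, -k - 1) =
        (S.translate a 1).sign (a, -k - 1 - 1) * (S.add (a, -k - 1)).translationSign a := by
      rw [← mul_right_inj ((S.add (a, -k - 1)).translationSign a), ← mul_assoc, mul_right_comm,
        hs, mul_assoc, mul_left_comm, mul_comm (Wedge.translationSign a S),
        mul_assoc, Int.units_mul_self, mul_one, mul_left_comm, Int.units_mul_self, mul_one]
    have h' := mt hm.1 h
    simp only [Q_apply, psiMinus, interiorOp, hk, ht, hd, h, h', if_false]
    simp only [← mul_assoc, ← Int.cast_mul, ← Units.val_mul, hs']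

theorem Q_psiPlus_ne (a b : Fin 3) (hb : b ≠ a) (k : ℤ) (φ : Fock R) :
    Q R a (psiPlus b k φ) = -psiPlus b k (Q R a φ) := by
  funext S
  obtain ⟨S, rfl⟩ : ∃ S' : Wedge, S = S'.translate a 1 :=
    ⟨S.translate a (-1), (Wedge.translate_translate a (-1) 1 (by norm_num) S).symm⟩
  have hm : (b, k) ∈ (S.translate a 1).modes ↔ (b, k) ∈ S.modes := by
    simp [Wedge.translate, hb]
  have ht := Wedge.translate_translate a 1 (-1) (by norm_num) S
  have hd : ((S.translate a 1).del (b, k)).translate a (-1) = S.del (b, k) := by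
    rw [Wedge.translate_del_ne a _ _ hb, ht]
  by_cases h : (b, k) ∈ S.modes
  · simp only [Pi.neg_apply, Q_apply, psiPlus, exteriorOp, ht, hd, h, hm.2 h, if_true]
    simp only [← mul_assoc, ← Int.cast_mul, ← Units.val_mul, Wedge.sign_ne a (b, k) hb S h,
      Units.val_neg, Int.cast_neg, neg_mul]
  · simp [Q_apply, psiPlus, exteriorOp, ht, h, hm]

theorem Q_psiMinus_ne (a b : Fin 3) (hb : b ≠ a) (k : ℤ) (φ : Fock R) :
    Q R a (psiMinus b k φ) = -psiMinus b k (Q R a φ) := by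
  funext S
  obtain ⟨S, rfl⟩ : ∃ S' : Wedge, S = S'.translate a 1 :=
    ⟨S.translate a (-1), (Wedge.translate_translate a (-1) 1 (by norm_num) S).symm⟩
  have hm : (b, -k - 1) ∈ (S.translate a 1).modes ↔ (b, -k - 1) ∈ S.modes := by
    simp [Wedge.translate, hb]
  have ht := Wedge.translate_translate a 1 (-1) (by norm_num) S
  have hd : ((S.translate a 1).add (b, -k - 1)).translate a (-1) = S.add (b, -k - 1) := by
    rw [Wedge.translate_add_ne a _ _ hb, ht]
  by_cases h : (b, -k - 1) ∈ S.modes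
  · simp [Q_apply, psiMinus, interiorOp, ht, h, hm.2 h]
  · have hs := Wedge.sign_ne a (b, -k - 1) hb (S.add (b, -k - 1)) (Set.mem_insert _ _)
    rw [Wedge.add_del S _ h, Wedge.translate_add_ne a _ _ hb, Wedge.sign, Wedge.sign,
      Wedge.earlier_add, Wedge.earlier_add, ← Wedge.sign, ← Wedge.sign] at hs
    have hs' : S.translationSign a * S.sign (b, -k - 1) =
        -((S.translate a 1).sign (b, -k - 1) * (S.add (b, -k - 1)).translationSign a) := by
      rw [← mul_right_inj ((S.add (b, -k - 1)).translationSign a), ← mul_assoc, mul_right_comm,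
        hs, mul_neg, neg_mul, mul_assoc, Int.units_mul_self, mul_one, mul_left_comm,
        Int.units_mul_self, mul_one]
    have h' := mt hm.1 h
    simp only [Pi.neg_apply, Q_apply, psiMinus, interiorOp, ht, hd, h, h', if_false]
    simp only [← mul_assoc, ← Int.cast_mul, ← Units.val_mul, hs', Units.val_neg, Int.cast_neg,
      neg_mul]

theorem Q_vacuum (a : Fin 3) : Q R a (v₀ R) = psiPlus a (-1) (v₀ R) := by
  funext S
  simp only [Q_apply, psiPlus, exteriorOp, v₀, wedge, Pi.single_apply]
  have h1 : S.translate a (-1) = vac ↔ S = vac.add (a, -1) := by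
    have key : (vac.add (a, -1)).translate a (-1) = vac := by
      ext ⟨x, i⟩
      by_cases hx : x = a
      · simp only [Wedge.translate, Wedge.add, vac, sea, hx, if_true, Set.mem_ofPred_eq,
          Set.mem_insert_iff, Prod.mk.injEq, true_and]
        omega
      · simp [Wedge.translate, Wedge.add, vac, sea, hx]
    constructor
    · intro h
      rw [← Wedge.translate_translate a (-1) 1 (by norm_num) S, h, ← key,
        Wedge.translate_translate a (-1) 1 (by norm_num)]
      rw [key]
    · rintro rfl
      exact key
  have hv : (a, -1) ∉ vac.modes := by simp [vac, sea]
  by_cases h : S = vac.add (a, -1)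
  · have hm : (a, -1) ∈ S.modes := h ▸ Set.mem_insert _ _
    have hd : S.del (a, -1) = vac := by rw [h, Wedge.add_del _ _ hv]
    have hc : vac.crossings a = ∅ := by
      ext ⟨x, i⟩
      simp only [Wedge.crossings, vac, sea, Set.mem_ofPred_eq, Set.mem_empty_iff_false, iff_false]
      rintro ⟨p, -, q⟩
      split_ifs at q <;> omega
    have he : S.earlier (a, -1) = ∅ := by
      rw [h, Wedge.earlier_add]
      ext ⟨x, i⟩
      simp only [Wedge.earlier, place, vac, sea, Set.mem_ofPred_eq, Set.mem_empty_iff_false,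
        iff_false]
      omega
    rw [h1.2 h]
    simp [hm, hd, Wedge.translationSign, Wedge.sign, hc, he]
  · rw [if_neg (fun h' => h (h1.1 h'))]
    split_ifs with hm hd
    · refine absurd ?_ h
      rw [← hd]
      ext x
      by_cases hx : x = (a, -1) <;> simp [Wedge.add, Wedge.del, hx, hm]
    · simp
    · simp

/-- `T₁ = Q₁ Q₀⁻¹`. -/
def T₁ : Fock R ≃ₗ[R] Fock R := Q R 1 * (Q R 0)⁻¹

/-- `T₂ = Q₂ Q₁⁻¹`. -/
def T₂ : Fock R ≃ₗ[R] Fock R := Q R 2 * (Q R 1)⁻¹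

variable {R}

/-! ### Tau-functions -/

/-- The coefficients of `f^(γ)(z) = ∑ i, f_(i+γ) / z^(i+1)`. -/
def shiftSeries (f : ℤ → R) (γ : ℤ) : ℤ → R := fun i => f (i + γ)

/-- `τ_{k,ℓ}^{(α,β)} = ⟨g^{(α,β)} v₀, T₁^k T₂^ℓ v₀⟩`, where `g^{(α,β)}` lies over the loop matrix
`[[1, 0, 0], [C^(α-β), 1, 0], [D^(α), E^(β), 1]]`. The sums in the action of `g^{(α,β)}` are
finite when `E^(β) = 0`. -/
def tau [Algebra ℂ R] (c d e : ℤ → R) (α β k ℓ : ℤ) : R :=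
  pairing
    (groupAction (shiftSeries c (α - β)) (shiftSeries d α) (shiftSeries e β) (v₀ R))
    ((T₁ R ^ k * T₂ R ^ ℓ) (v₀ R))

/-- The `k × k` matrix whose first `ℓ` columns are `(d_(α+j), d_(α+j+1), …)` and whose last
`k - ℓ` columns are `(c_(α-β+j), c_(α-β+j+1), …)`. -/
def momentMatrix (c d : ℤ → R) (α β : ℤ) (k ℓ : ℕ) : Matrix (Fin k) (Fin k) R :=
  Matrix.of fun i j =>
    if j.val < ℓ then d (α + i.val + j.val) else c (α - β + i.val + (j.val - ℓ))

/-- The same columns with one more row, bordered by the last column `(1, z, …, z^k)`. -/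
def borderedMatrix (c d : ℤ → R) (z : R) (α β : ℤ) (k ℓ : ℕ) :
    Matrix (Fin (k + 1)) (Fin (k + 1)) R :=
  Matrix.of fun i j =>
    if j.val < ℓ then d (α + i.val + j.val)
    else if j.val < k then c (α - β + i.val + (j.val - ℓ))
    else z ^ i.val

/-! ### Shift fields -/

/-- `ℂ[z, z⁻¹][c_i, d_i, e_i]`, `i ∈ ℤ`; the variables are `X (0, i)`, `X (1, i)`, `X (2, i)`. -/
abbrev FormalRing : Type := MvPolynomial (Fin 3 × ℤ) ℂ[T;T⁻¹]

/-- The formal variable `c_i`. -/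
def cVar (i : ℤ) : FormalRing := MvPolynomial.X (0, i)

/-- The formal variable `d_i`. -/
def dVar (i : ℤ) : FormalRing := MvPolynomial.X (1, i)

/-- The power `z^n`. -/
def zPow (n : ℤ) : FormalRing := MvPolynomial.C (LaurentPolynomial.T n)

/-- The multiplicative shift field `1 - S/z` in the variables of kind `a`
(`a = 0` for `c`, `a = 1` for `d`, `a = 2` for `e`): `x_i ↦ x_i - x_(i+1) / z` on the variables
of that kind, all others fixed. -/
def shiftPlus (a : Fin 3) : FormalRing →ₐ[ℂ[T;T⁻¹]] FormalRing :=
  MvPolynomial.aeval fun v : Fin 3 × ℤ =>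
    if v.1 = a then MvPolynomial.X v - zPow (-1) * MvPolynomial.X (v.1, v.2 + 1)
    else MvPolynomial.X v

end FermionicFock

end

noncomputable section

namespace FermionicFock

theorem place_injective : Function.Injective place := by
  rintro ⟨a, i⟩ ⟨b, j⟩ h
  simp only [place] at h
  have ha := a.isLt
  have hb := b.isLt
  have h1 : a.val = b.val := by omega
  have h2 : i = j := by omega
  exact Prod.ext (Fin.ext h1) h2

theorem Wedge.mem_add (S : Wedge) (b x : Mode) : x ∈ (S.add b).modes ↔ x = b ∨ x ∈ S.modes :=
  Set.mem_insert_iff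

theorem Wedge.mem_del (S : Wedge) (b x : Mode) : x ∈ (S.del b).modes ↔ x ∈ S.modes ∧ x ≠ b :=
  Iff.rfl

theorem Wedge.del_add (S : Wedge) (b : Mode) (h : b ∈ S.modes) : (S.del b).add b = S := by
  ext x
  simp only [Wedge.mem_add, Wedge.mem_del]
  by_cases hx : x = b <;> simp_all

theorem Wedge.add_add_comm (S : Wedge) (b b' : Mode) : (S.add b).add b' = (S.add b').add b := by
  ext x
  simp only [Wedge.mem_add]
  tauto

theorem Wedge.del_del_comm (S : Wedge) (b b' : Mode) : (S.del b).del b' = (S.del b').del b := by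
  ext x
  simp only [Wedge.mem_del]
  tauto

theorem Wedge.add_del_comm (S : Wedge) (b b' : Mode) (h : b ≠ b') :
    (S.add b).del b' = (S.del b').add b := by
  ext x
  simp only [Wedge.mem_add, Wedge.mem_del]
  by_cases hx : x = b <;> simp_all

theorem Wedge.sign_add_self (S : Wedge) (b : Mode) : (S.add b).sign b = S.sign b := by
  rw [Wedge.sign, Wedge.sign, Wedge.earlier_add]

theorem Wedge.sign_add (S : Wedge) (b b' : Mode) (h : b' ∉ S.modes) :
    (S.add b').sign b = (if place b' < place b then -1 else 1) * S.sign b := by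
  have hE := S.finite_earlier b
  split_ifs with hlt
  · have : (S.add b').earlier b = insert b' (S.earlier b) := by
      ext x
      simp only [Wedge.earlier, Wedge.mem_add, Set.mem_ofPred_eq, Set.mem_insert_iff]
      by_cases hx : x = b' <;> simp_all
    rw [Wedge.sign, Wedge.sign, this, Set.ncard_insert_of_notMem (fun hx => h hx.1) hE, pow_succ']
  · have : (S.add b').earlier b = S.earlier b := by
      ext x
      simp only [Wedge.earlier, Wedge.mem_add, Set.mem_ofPred_eq]
      by_cases hx : x = b' <;> simp_all
    rw [Wedge.sign, Wedge.sign, this, one_mul]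

theorem Wedge.sign_del (S : Wedge) (b b' : Mode) (h : b' ∈ S.modes) :
    (S.del b').sign b = (if place b' < place b then -1 else 1) * S.sign b := by
  have h1 := (S.del b').sign_add b b' (fun hx => hx.2 rfl)
  rw [Wedge.del_add _ _ h] at h1
  rw [h1, ← mul_assoc, Int.units_mul_self, one_mul]

theorem Wedge.sign_del_self (S : Wedge) (b : Mode) : (S.del b).sign b = S.sign b := by
  by_cases h : b ∈ S.modes
  · rw [← Wedge.sign_add_self, Wedge.del_add _ _ h]
  · congr 1
    ext x
    simp only [Wedge.mem_del]
    by_cases hx : x = b <;> simp_all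

variable {R : Type*} [CommRing R]

/-- The exterior product operator as a linear map. -/
def ext (b : Mode) : Module.End R (Fock R) where
  toFun := exteriorOp b
  map_add' φ ψ := by
    funext S
    simp only [exteriorOp, Pi.add_apply]
    split_ifs <;> ring
  map_smul' r φ := by
    funext S
    simp only [exteriorOp, Pi.smul_apply, smul_eq_mul, RingHom.id_apply]
    split_ifs <;> ring

/-- The interior product operator as a linear map. -/
def int (b : Mode) : Module.End R (Fock R) where
  toFun := interiorOp b
  map_add' φ ψ := by
    funext S
    simp only [interiorOp, Pi.add_apply]
    split_ifs <;> ring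
  map_smul' r φ := by
    funext S
    simp only [interiorOp, Pi.smul_apply, smul_eq_mul, RingHom.id_apply]
    split_ifs <;> ring

open Classical in
theorem ext_apply (b : Mode) (φ : Fock R) (S : Wedge) :
    ext b φ S = if b ∈ S.modes then ((S.sign b : ℤ) : R) * φ (S.del b) else 0 := rfl

open Classical in
theorem int_apply (b : Mode) (φ : Fock R) (S : Wedge) :
    int b φ S = if b ∈ S.modes then 0 else ((S.sign b : ℤ) : R) * φ (S.add b) := rfl

theorem place_lt_cases {b b' : Mode} (h : b ≠ b') :
    (place b < place b' ∧ ¬ place b' < place b) ∨ (place b' < place b ∧ ¬ place b < place b') := by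
  have := place_injective.ne h
  omega

theorem int_mul_int (b b' : Mode) :
    (int b * int b' : Module.End R (Fock R)) = -(int b' * int b) := by
  refine LinearMap.ext fun φ => funext fun S => ?_
  simp only [Module.End.mul_apply, LinearMap.neg_apply, Pi.neg_apply, int_apply]
  by_cases hb : b ∈ S.modes
  · simp [Wedge.mem_add, hb]
  by_cases hb' : b' ∈ S.modes
  · simp [Wedge.mem_add, hb']
  by_cases h : b = b'
  · subst h
    simp [Wedge.mem_add, hb]
  · rw [Wedge.sign_add _ _ _ hb, Wedge.sign_add _ _ _ hb', Wedge.add_add_comm S b b']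
    rcases place_lt_cases h with ⟨h1, h2⟩ | ⟨h1, h2⟩ <;>
      simp [Wedge.mem_add, hb, hb', h, Ne.symm h, h1, h2, mul_left_comm]

theorem ext_mul_ext (b b' : Mode) :
    (ext b * ext b' : Module.End R (Fock R)) = -(ext b' * ext b) := by
  refine LinearMap.ext fun φ => funext fun S => ?_
  simp only [Module.End.mul_apply, LinearMap.neg_apply, Pi.neg_apply, ext_apply]
  by_cases hb : b ∈ S.modes
  swap
  · simp [Wedge.mem_del, hb]
  by_cases hb' : b' ∈ S.modes
  swap
  · simp [Wedge.mem_del, hb']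
  by_cases h : b = b'
  · subst h
    simp [Wedge.mem_del, hb]
  · rw [Wedge.sign_del _ _ _ hb, Wedge.sign_del _ _ _ hb', Wedge.del_del_comm S b b']
    rcases place_lt_cases h with ⟨h1, h2⟩ | ⟨h1, h2⟩ <;>
      simp [Wedge.mem_del, hb, hb', h, Ne.symm h, h1, h2, mul_left_comm]

theorem int_mul_ext (b b' : Mode) (h : b ≠ b') :
    (int b * ext b' : Module.End R (Fock R)) = -(ext b' * int b) := by
  refine LinearMap.ext fun φ => funext fun S => ?_
  simp only [Module.End.mul_apply, LinearMap.neg_apply, Pi.neg_apply, ext_apply, int_apply]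
  by_cases hb : b ∈ S.modes
  · simp [Wedge.mem_del, hb, h]
  by_cases hb' : b' ∈ S.modes
  swap
  · simp [Wedge.mem_add, hb', h.symm]
  rw [Wedge.sign_add _ _ _ hb, Wedge.sign_del _ _ _ hb', Wedge.add_del_comm S b b' h]
  rcases place_lt_cases h with ⟨h1, h2⟩ | ⟨h1, h2⟩ <;>
      simp [Wedge.mem_add, Wedge.mem_del, hb, hb', h, Ne.symm h, h1, h2, mul_left_comm]

theorem units_cast_mul_self_mul (u : ℤˣ) (x : R) : ((u : ℤ) : R) * (((u : ℤ) : R) * x) = x := by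
  rw [← mul_assoc, ← Int.cast_mul, Int.units_coe_mul_self, Int.cast_one, one_mul]

open Classical in
theorem ext_int_apply (b : Mode) (φ : Fock R) (S : Wedge) :
    ext b (int b φ) S = if b ∈ S.modes then φ S else 0 := by
  simp only [ext_apply, int_apply, Wedge.mem_del]
  split_ifs with h h'
  · exact absurd rfl h'.2
  · rw [Wedge.sign_del_self, units_cast_mul_self_mul, Wedge.del_add _ _ h]
  · rfl

open Classical in
theorem int_ext_apply (b : Mode) (φ : Fock R) (S : Wedge) :
    int b (ext b φ) S = if b ∈ S.modes then 0 else φ S := by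
  simp only [ext_apply, int_apply, Wedge.mem_add, true_or, if_true]
  split_ifs with h
  · rfl
  · rw [Wedge.sign_add_self, units_cast_mul_self_mul, Wedge.add_del _ _ h]

theorem int_mul_ext_self (b : Mode) :
    (int b * ext b : Module.End R (Fock R)) = 1 - ext b * int b := by
  refine LinearMap.ext fun φ => funext fun S => ?_
  simp only [Module.End.mul_apply, LinearMap.sub_apply, Pi.sub_apply, Module.End.one_apply,
    int_ext_apply, ext_int_apply]
  split_ifs <;> simp

theorem ext_v₀ (b : Mode) (h : 0 ≤ b.2) : ext b (v₀ R) = 0 := by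
  funext S
  simp only [ext_apply, v₀, wedge, Pi.single_apply, Pi.zero_apply]
  split_ifs with h1 h2
  · exact absurd (show b ∈ (S.del b).modes from h2 ▸ h) (fun hx => hx.2 rfl)
  · simp
  · rfl

theorem int_v₀ (b : Mode) (h : b.2 < 0) : int b (v₀ R) = 0 := by
  funext S
  simp only [int_apply, v₀, wedge, Pi.single_apply, Pi.zero_apply]
  split_ifs with h1 h2
  · rfl
  · have h3 : b ∈ (S.add b).modes := Set.mem_insert _ _
    rw [h2] at h3
    exact absurd h (not_lt.2 h3)
  · simp

theorem pairing_ext (b : Mode) (φ ψ : Fock R) : pairing φ (ext b ψ) = pairing (int b φ) ψ := by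
  classical
  have h1 : pairing φ (ext b ψ) = ∑ᶠ (S : Wedge) (_ : S ∈ {S : Wedge | b ∈ S.modes}),
      φ S * ext b ψ S := by
    refine finsum_congr fun S => ?_
    by_cases h : b ∈ S.modes <;> simp [h, ext_apply]
  have h2 : pairing (int b φ) ψ = ∑ᶠ (S : Wedge) (_ : S ∈ {S : Wedge | b ∉ S.modes}),
      int b φ S * ψ S := by
    refine finsum_congr fun S => ?_
    by_cases h : b ∈ S.modes <;> simp [h, int_apply]
  rw [h1, h2]
  refine finsum_mem_eq_of_bijOn (fun S => S.del b) ⟨fun S _ hx => hx.2 rfl, ?_, ?_⟩ ?_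
  · intro S hS S' hS' h
    simp only at h
    rw [← S.del_add b hS, h, S'.del_add b hS']
  · intro S hS
    exact ⟨S.add b, Set.mem_insert _ _, S.add_del b hS⟩
  · intro S hS
    have h' : b ∉ (S.del b).modes := fun hx => hx.2 rfl
    have hS' : b ∈ S.modes := hS
    rw [ext_apply, int_apply, if_pos hS', if_neg h', Wedge.sign_del_self, S.del_add b hS]
    ring

theorem pairing_comm (φ ψ : Fock R) : pairing φ ψ = pairing ψ φ :=
  finsum_congr fun _ => mul_comm _ _

theorem pairing_int (b : Mode) (φ ψ : Fock R) : pairing φ (int b ψ) = pairing (ext b φ) ψ := by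
  rw [pairing_comm, ← pairing_ext, pairing_comm]

theorem pairing_v₀ (φ : Fock R) : pairing φ (v₀ R) = φ vac := by
  classical
  rw [pairing, finsum_eq_single _ vac]
  · simp [v₀, wedge]
  · intro S hS
    simp [v₀, wedge, hS]

theorem pairing_zsmul (u : ℤˣ) (φ ψ : Fock R) :
    pairing φ ((u : ℤ) • ψ) = (u : ℤ) • pairing φ ψ := by
  rcases Int.units_eq_one_or u with rfl | rfl
  · simp
  · simp [pairing, finsum_neg_distrib]

/-- The amount by which `Q_a` lowers the power of `z` in component `b`. -/
def shift (a b : Fin 3) : ℤ := if b = a then 1 else 0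

/-- The sign in the commutation relation of `Q_a` with the fermions of component `b`. -/
def eps (a b : Fin 3) : ℤˣ := if b = a then 1 else -1

theorem Q_ext (a b : Fin 3) (j : ℤ) (φ : Fock R) :
    Q R a (ext (b, j) φ) = (eps a b : ℤ) • ext (b, j - shift a b) (Q R a φ) := by
  by_cases h : b = a
  · subst h
    simp only [eps, shift, if_true, Units.val_one, one_smul]
    exact Q_psiPlus_self R b j φ
  · simp only [eps, shift, h, if_false, Units.val_neg, Units.val_one, neg_smul, one_smul, sub_zero]
    exact Q_psiPlus_ne R a b h j φ

theorem Q_int (a b : Fin 3) (j : ℤ) (φ : Fock R) :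
    Q R a (int (b, j) φ) = (eps a b : ℤ) • int (b, j - shift a b) (Q R a φ) := by
  by_cases h : b = a
  · subst h
    have := Q_psiMinus_self R b (-j - 1) φ
    simp only [psiMinus, show -(-j - 1) - 1 = j by ring,
      show -(-j - 1 + 1) - 1 = j - 1 by ring] at this
    simp only [eps, shift, if_true, Units.val_one, one_smul]
    exact this
  · have := Q_psiMinus_ne R a b h (-j - 1) φ
    simp only [psiMinus, show -(-j - 1) - 1 = j by ring] at this
    simp only [eps, shift, h, if_false, Units.val_neg, Units.val_one, neg_smul, one_smul, sub_zero]
    exact this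

theorem Q_Q_inv (a : Fin 3) (φ : Fock R) : Q R a ((Q R a)⁻¹ φ) = φ :=
  (Q R a).apply_symm_apply φ

theorem Q_inv_ext (a b : Fin 3) (j : ℤ) (φ : Fock R) :
    (Q R a)⁻¹ (ext (b, j) φ) = (eps a b : ℤ) • ext (b, j + shift a b) ((Q R a)⁻¹ φ) := by
  apply (Q R a).injective
  rw [Q_Q_inv, map_zsmul, Q_ext, Q_Q_inv, smul_smul, Int.units_coe_mul_self, one_smul,
    add_sub_cancel_right]

theorem Q_inv_int (a b : Fin 3) (j : ℤ) (φ : Fock R) :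
    (Q R a)⁻¹ (int (b, j) φ) = (eps a b : ℤ) • int (b, j + shift a b) ((Q R a)⁻¹ φ) := by
  apply (Q R a).injective
  rw [Q_Q_inv, map_zsmul, Q_int, Q_Q_inv, smul_smul, Int.units_coe_mul_self, one_smul,
    add_sub_cancel_right]

/-- The commutation of the translation `Q_a Q_b⁻¹` with exterior products. -/
theorem Q_mul_Q_inv_ext (a a' b : Fin 3) (j : ℤ) (φ : Fock R) :
    (Q R a * (Q R a')⁻¹) (ext (b, j) φ) = ((eps a b * eps a' b : ℤˣ) : ℤ) •
      ext (b, j + shift a' b - shift a b) ((Q R a * (Q R a')⁻¹) φ) := by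
  simp only [LinearEquiv.mul_apply, Q_inv_ext, map_zsmul, Q_ext, smul_smul, Units.val_mul]
  rw [mul_comm]

/-- The commutation of the translation `Q_a Q_b⁻¹` with interior products. -/
theorem Q_mul_Q_inv_int (a a' b : Fin 3) (j : ℤ) (φ : Fock R) :
    (Q R a * (Q R a')⁻¹) (int (b, j) φ) = ((eps a b * eps a' b : ℤˣ) : ℤ) •
      int (b, j + shift a' b - shift a b) ((Q R a * (Q R a')⁻¹) φ) := by
  simp only [LinearEquiv.mul_apply, Q_inv_int, map_zsmul, Q_int, smul_smul, Units.val_mul]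
  rw [mul_comm]

theorem Q_inv_v₀ (a : Fin 3) : (Q R a)⁻¹ (v₀ R) = int (a, 0) (v₀ R) := by
  apply (Q R a).injective
  have h : int (a, -1) (ext (a, -1) (v₀ R)) = v₀ R := by
    rw [← Module.End.mul_apply, int_mul_ext_self, LinearMap.sub_apply, Module.End.mul_apply,
      int_v₀ _ (by norm_num)]
    simp
  rw [Q_Q_inv, Q_int, Q_vacuum]
  simpa [eps, shift] using h.symm.trans (congrArg (int (a, -1)) (rfl : _ = psiPlus a (-1) (v₀ R)))

theorem Q_mul_Q_inv_v₀ (a a' : Fin 3) (h : a ≠ a') :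
    (Q R a * (Q R a')⁻¹) (v₀ R) = ext (a, -1) (int (a', 0) (v₀ R)) := by
  rw [LinearEquiv.mul_apply, Q_inv_v₀, Q_int, Q_vacuum]
  have h1 := LinearMap.congr_fun (int_mul_ext (R := R) (a', 0) (a, -1) (by simp)) (v₀ R)
  simp only [Module.End.mul_apply, LinearMap.neg_apply] at h1
  have h2 : psiPlus a (-1) (v₀ R) = ext (a, -1) (v₀ R) := rfl
  simp [eps, shift, h.symm, h2, h1]

/-- The vectors, up to sign, that creation and annihilation operators make from the vacuum. -/
inductive Reachable : Fock R → Prop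
  | vac : Reachable (v₀ R)
  | exterior (b : Mode) {φ : Fock R} : Reachable φ → Reachable (ext b φ)
  | interior (b : Mode) {φ : Fock R} : Reachable φ → Reachable (int b φ)
  | neg {φ : Fock R} : Reachable φ → Reachable (-φ)

theorem Reachable.units_smul {φ : Fock R} (h : Reachable φ) (u : ℤˣ) :
    Reachable ((u : ℤ) • φ) := by
  rcases Int.units_eq_one_or u with rfl | rfl
  · simpa using h
  · simpa using h.neg

theorem Reachable.Q_mul_Q_inv {φ : Fock R} (h : Reachable φ) (a a' : Fin 3) (ha : a ≠ a') :
    Reachable ((Q R a * (Q R a')⁻¹) φ) := by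
  induction h with
  | vac =>
    rw [Q_mul_Q_inv_v₀ a a' ha]
    exact .exterior _ (.interior _ .vac)
  | exterior b _ ih =>
    rw [Q_mul_Q_inv_ext]
    exact (ih.exterior _).units_smul _
  | interior b _ ih =>
    rw [Q_mul_Q_inv_int]
    exact (ih.interior _).units_smul _
  | neg _ ih =>
    rw [map_neg]
    exact ih.neg

theorem Reachable.T₁_T₂ {φ : Fock R} (h : Reachable φ) :
    T₁ R (T₂ R φ) = -T₂ R (T₁ R φ) := by
  unfold T₁ T₂
  induction h with
  | vac =>
    rw [Q_mul_Q_inv_v₀ 1 0 (by decide), Q_mul_Q_inv_v₀ 2 1 (by decide), Q_mul_Q_inv_ext,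
      Q_mul_Q_inv_int, Q_mul_Q_inv_ext, Q_mul_Q_inv_int, Q_mul_Q_inv_v₀ 1 0 (by decide),
      Q_mul_Q_inv_v₀ 2 1 (by decide)]
    have e1 : int (1, -1) (ext (1, -1) (int (0, 0) (v₀ R))) = int (0, 0) (v₀ R) := by
      rw [← Module.End.mul_apply (int (1, -1)), int_mul_ext_self, LinearMap.sub_apply,
        Module.End.mul_apply, ← Module.End.mul_apply (int (1, -1)), int_mul_int,
        LinearMap.neg_apply, Module.End.mul_apply, int_v₀ (1, -1) (by norm_num)]
      simp
    have e2 : ext (1, 0) (int (0, 0) (ext (2, -1) (int (1, 0) (v₀ R)))) =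
        -ext (2, -1) (int (0, 0) (v₀ R)) := by
      have c1 := LinearMap.congr_fun (int_mul_ext (R := R) (0, 0) (2, -1) (by simp))
        (int (1, 0) (v₀ R))
      have c2 := LinearMap.congr_fun (ext_mul_ext (R := R) (1, 0) (2, -1))
        (int (0, 0) (int (1, 0) (v₀ R)))
      have c3 := LinearMap.congr_fun (int_mul_int (R := R) (0, 0) (1, 0)) (v₀ R)
      have c4 := LinearMap.congr_fun (int_mul_ext_self (R := R) (1, 0)) (int (0, 0) (v₀ R))
      have c5 := LinearMap.congr_fun (int_mul_ext (R := R) (0, 0) (1, 0) (by simp)) (v₀ R)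
      simp only [Module.End.mul_apply, LinearMap.neg_apply, LinearMap.sub_apply,
        Module.End.one_apply] at c1 c2 c3 c4 c5
      rw [ext_v₀ (1, 0) le_rfl, map_zero, eq_comm, neg_eq_zero] at c5
      rw [c5, map_zero, eq_comm, sub_eq_zero] at c4
      rw [c1, map_neg, c2, c3, map_neg, ← c4]
      simp
    simp [eps, shift, e1, e2]
  | exterior b _ ih =>
    obtain ⟨b, j⟩ := b
    simp only [Q_mul_Q_inv_ext, map_zsmul, smul_smul, ih, map_neg, smul_neg]
    rw [mul_comm]
    congr 4
    exact Prod.ext rfl (by dsimp only; ring)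
  | interior b _ ih =>
    obtain ⟨b, j⟩ := b
    simp only [Q_mul_Q_inv_int, map_zsmul, smul_smul, ih, map_neg, smul_neg]
    rw [mul_comm]
    congr 4
    exact Prod.ext rfl (by dsimp only; ring)
  | neg _ ih => simp only [map_neg, ih]

/-- The product `P (n - 1) * ⋯ * P 1 * P 0`. -/
def descProd {M : Type*} [Monoid M] (P : ℕ → M) : ℕ → M
  | 0 => 1
  | n + 1 => P n * descProd P n

theorem descProd_add {M : Type*} [Monoid M] (P : ℕ → M) (m n : ℕ) :
    descProd P (m + n) = descProd (fun i => P (i + n)) m * descProd P n := by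
  induction m with
  | zero => simp [descProd]
  | succ m ih => rw [Nat.add_right_comm, descProd, ih, descProd, mul_assoc]

theorem descProd_congr {M : Type*} [Monoid M] {P P' : ℕ → M} {n : ℕ}
    (h : ∀ i < n, P i = P' i) : descProd P n = descProd P' n := by
  induction n with
  | zero => rfl
  | succ n ih => rw [descProd, descProd, h n (by omega), ih fun i hi => h i (by omega)]

/-- Moving an operator that skew-commutes with each factor through a product. -/
theorem map_descProd (T : Fock R ≃ₗ[R] Fock R) (P P' : ℕ → Module.End R (Fock R)) (u : ℤˣ)
    (h : ∀ i φ, T (P i φ) = (u : ℤ) • P' i (T φ)) (n : ℕ) (φ : Fock R) :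
    T (descProd P n φ) = ((u ^ n : ℤˣ) : ℤ) • descProd P' n (T φ) := by
  induction n with
  | zero => simp [descProd]
  | succ n ih =>
    rw [descProd, Module.End.mul_apply, h, ih, map_zsmul, smul_smul, descProd,
      Module.End.mul_apply, pow_succ', Units.val_mul]

/-- The replacement of `e₀ z^(i+ℓ)` by `e₁ z^(-1-i)`. -/
def pair₁ (R : Type*) [CommRing R] (ℓ i : ℕ) : Module.End R (Fock R) :=
  ext (1, -1 - i) * int (0, i + ℓ)

/-- The replacement of `e₀ z^i` by `e₂ z^(-1-i)`. -/
def pair₂ (R : Type*) [CommRing R] (i : ℕ) : Module.End R (Fock R) :=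
  ext (2, -1 - i) * int (0, i)

theorem T₁_pair₁ (i : ℕ) (φ : Fock R) :
    T₁ R (pair₁ R 0 i φ) = pair₁ R 0 (i + 1) (T₁ R φ) := by
  simp only [pair₁, T₁, Module.End.mul_apply, Q_mul_Q_inv_ext, Q_mul_Q_inv_int, map_zsmul,
    smul_smul]
  simp [eps, shift, sub_eq_add_neg, add_comm, add_left_comm]

theorem T₂_T₁_pair₁ (ℓ i : ℕ) (φ : Fock R) :
    T₂ R (T₁ R (pair₁ R ℓ i φ)) = -pair₁ R (ℓ + 1) i (T₂ R (T₁ R φ)) := by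
  simp only [pair₁, T₁, T₂, Module.End.mul_apply, Q_mul_Q_inv_ext, Q_mul_Q_inv_int, map_zsmul,
    smul_smul]
  simp [eps, shift, add_assoc]

theorem T₂_T₁_pair₂ (i : ℕ) (φ : Fock R) :
    T₂ R (T₁ R (pair₂ R i φ)) = pair₂ R (i + 1) (T₂ R (T₁ R φ)) := by
  simp only [pair₂, T₁, T₂, Module.End.mul_apply, Q_mul_Q_inv_ext, Q_mul_Q_inv_int, map_zsmul,
    smul_smul]
  simp [eps, shift, sub_eq_add_neg, add_comm]

theorem T₁_v₀ : T₁ R (v₀ R) = pair₁ R 0 0 (v₀ R) := by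
  rw [T₁, Q_mul_Q_inv_v₀ 1 0 (by decide)]
  simp [pair₁]

theorem T₂_T₁_v₀ : T₂ R (T₁ R (v₀ R)) = pair₂ R 0 (v₀ R) := by
  have h : T₂ R (T₁ R (v₀ R)) = (Q R 2 * (Q R 0)⁻¹) (v₀ R) := by
    simp only [T₁, T₂, LinearEquiv.mul_apply]
    congr 1
    exact (Q R 1).symm_apply_apply _
  rw [h, Q_mul_Q_inv_v₀ 2 0 (by decide)]
  simp [pair₂]

theorem T₁_pow_v₀ (m : ℕ) : (T₁ R ^ m) (v₀ R) = descProd (pair₁ R 0) m (v₀ R) := by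
  induction m with
  | zero => simp [descProd]
  | succ m ih =>
    have h := map_descProd (T₁ R) (pair₁ R 0) (fun i => pair₁ R 0 (i + 1)) 1
      (fun i φ => by simp [T₁_pair₁]) m (v₀ R)
    rw [pow_succ', LinearEquiv.mul_apply, ih, h, T₁_v₀, descProd_add]
    simp [descProd]

theorem T₁_pow_T₂_pow_v₀ (m ℓ : ℕ) : (T₁ R ^ (m + ℓ) * T₂ R ^ ℓ) (v₀ R) =
    (((-1) ^ (ℓ * (ℓ + 1) / 2) : ℤˣ) : ℤ) •
      descProd (pair₁ R ℓ) m (descProd (pair₂ R) ℓ (v₀ R)) := by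
  have hR : ∀ n φ, Reachable φ → Reachable ((T₁ R ^ n) φ) := by
    intro n φ hφ
    induction n with
    | zero => simpa using hφ
    | succ n ih =>
      rw [pow_succ', LinearEquiv.mul_apply]
      exact ih.Q_mul_Q_inv 1 0 (by decide)
  have hR₂ : ∀ n, Reachable ((T₂ R ^ n) (v₀ R)) := by
    intro n
    induction n with
    | zero => simpa using Reachable.vac
    | succ n ih =>
      rw [pow_succ', LinearEquiv.mul_apply]
      exact ih.Q_mul_Q_inv 2 1 (by decide)
  have hC : ∀ n φ, Reachable φ → (T₁ R ^ n) (T₂ R φ) =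
      (((-1) ^ n : ℤˣ) : ℤ) • T₂ R ((T₁ R ^ n) φ) := by
    intro n φ hφ
    induction n with
    | zero => simp
    | succ n ih =>
      rw [pow_succ', LinearEquiv.mul_apply, LinearEquiv.mul_apply, ih, map_zsmul,
        (hR n φ hφ).T₁_T₂, pow_succ]
      simp
  induction ℓ with
  | zero =>
    simp only [pow_zero, mul_one, add_zero, T₁_pow_v₀]
    simp [descProd]
  | succ ℓ ih =>
    rw [LinearEquiv.mul_apply] at ih
    rw [LinearEquiv.mul_apply, pow_succ', LinearEquiv.mul_apply, hC _ _ (hR₂ ℓ), ← add_assoc,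
      pow_succ' (T₁ R), LinearEquiv.mul_apply, ih, map_zsmul, map_zsmul, smul_smul]
    have h1 := map_descProd (T₂ R * T₁ R) (pair₁ R ℓ) (pair₁ R (ℓ + 1)) (-1)
      (fun i φ => by simp [T₂_T₁_pair₁]) m (descProd (pair₂ R) ℓ (v₀ R))
    have h2 := map_descProd (T₂ R * T₁ R) (pair₂ R) (fun i => pair₂ R (i + 1)) 1
      (fun i φ => by simp [T₂_T₁_pair₂]) ℓ (v₀ R)
    simp only [LinearEquiv.mul_apply] at h1 h2
    rw [h1, h2, T₂_T₁_v₀, smul_smul, descProd_add (pair₂ R) ℓ 1]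
    have h3 : (-1 : ℤˣ) ^ (m + ℓ + 1) * (-1) ^ (ℓ * (ℓ + 1) / 2) * (-1) ^ m =
        (-1) ^ ((ℓ + 1) * (ℓ + 1 + 1) / 2) := by
      rw [show (ℓ + 1) * (ℓ + 1 + 1) = ℓ * (ℓ + 1) + (ℓ + 1) * 2 by ring,
        Nat.add_mul_div_right _ _ two_pos, pow_add _ _ (ℓ + 1), ← pow_add, ← pow_add, ← pow_add,
        show m + ℓ + 1 + ℓ * (ℓ + 1) / 2 + m = ℓ * (ℓ + 1) / 2 + (ℓ + 1) + 2 * m by ring,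
        pow_add _ _ (2 * m), pow_mul (-1 : ℤˣ) 2]
      simp
    rw [← Units.val_mul, ← Units.val_mul, h3]
    simp [descProd]

/-- The mode that replaces `e₀ z^i` in the elementary wedge `± T₁^k T₂^ℓ v₀`. -/
def newMode (ℓ i : ℕ) : Mode := if i < ℓ then (2, -1 - i) else (1, -1 - (i - ℓ : ℕ))

theorem T₁_pow_T₂_pow_v₀_eq_descProd (k ℓ : ℕ) (h : ℓ ≤ k) : (T₁ R ^ k * T₂ R ^ ℓ) (v₀ R) =
    (((-1) ^ (ℓ * (ℓ + 1) / 2) : ℤˣ) : ℤ) •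
      (descProd (fun i => ext (newMode ℓ i) * int (0, (i : ℤ))) k : Module.End R (Fock R)) (v₀ R) := by
  obtain ⟨m, rfl⟩ := Nat.exists_eq_add_of_le' h
  rw [T₁_pow_T₂_pow_v₀, descProd_add, Module.End.mul_apply]
  congr 2
  · refine descProd_congr fun i _ => ?_
    simp [pair₁, newMode]
  · refine congrArg (fun P : Module.End R (Fock R) => P _) ?_
    refine descProd_congr fun i hi => ?_
    simp [pair₂, newMode, hi]

/-- The wedges obtained from the vacuum by removing modes of component `0` and adding modes of the
other components. -/
def lowered : Set Wedge :=
  {S | (∀ j < 0, ((0, j) : Mode) ∉ S.modes) ∧ ∀ a ≠ 0, ∀ j ≥ 0, ((a, j) : Mode) ∈ S.modes}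

/-- The wedges that contain every `e₀ z^j` with `j ≥ k` and no `e_a z^j` with `a ≠ 0`, `j < -k`. -/
def window (k : ℕ) : Set Wedge :=
  {S | (∀ j ≥ (k : ℤ), ((0, j) : Mode) ∈ S.modes) ∧
    ∀ a ≠ 0, ∀ j < -(k : ℤ), ((a, j) : Mode) ∉ S.modes}

theorem vac_mem_lowered : vac ∈ lowered := ⟨fun _ hj => not_le.2 hj, fun _ _ _ hj => hj⟩

theorem vac_mem_window (k : ℕ) : vac ∈ window k :=
  ⟨fun j hj => show (0 : ℤ) ≤ j by omega, fun _ _ j hj => show ¬ (0 : ℤ) ≤ j by omega⟩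

theorem support_v₀_subset_lowered : Function.support (v₀ R) ⊆ lowered := by
  classical
  intro S hS
  by_cases h : S = vac
  · exact h ▸ vac_mem_lowered
  · simp [v₀, wedge, h] at hS

theorem ext_int_ne_zero {a : Fin 3} (ha : a ≠ 0) {φ : Fock R}
    (hφ : Function.support φ ⊆ lowered) {p j : ℤ} {S : Wedge}
    (h : ext (a, p) (int (0, j) φ) S ≠ 0) :
    S ∈ lowered ∧ (a, p) ∈ S.modes ∧ ((0, j) : Mode) ∉ S.modes ∧ p < 0 ∧ 0 ≤ j := by
  rw [ext_apply] at h
  split_ifs at h with h1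
  swap
  · exact absurd rfl h
  have h' := right_ne_zero_of_mul h
  rw [int_apply] at h'
  split_ifs at h' with h2
  · exact absurd rfl h'
  obtain ⟨h3, h4⟩ := hφ (right_ne_zero_of_mul h')
  simp only [Wedge.mem_add, Wedge.mem_del, ne_eq] at h2 h3 h4
  refine ⟨⟨fun i hi hS => h3 i hi (Or.inr ⟨hS, ?_⟩), fun a' ha' i hi => ?_⟩, h1, ?_, ?_, ?_⟩
  · simp [ha.symm]
  · rcases h4 a' ha' i hi with h5 | h5
    · exact absurd (congrArg Prod.fst h5) ha'
    · exact h5.1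
  · exact fun hS => h2 ⟨hS, by simp [ha.symm]⟩
  · by_contra hp
    rcases h4 a ha p (not_lt.1 hp) with h5 | h5
    · exact ha (congrArg Prod.fst h5)
    · exact h5.2 rfl
  · by_contra hj
    exact h3 j (not_le.1 hj) (Or.inl rfl)

theorem loopAction_apply (a b : Fin 3) (f : ℤ → R) (φ : Fock R) (S : Wedge) :
    loopAction a b f φ S =
      ∑ᶠ i : ℤ, f i * ∑ᶠ q : ℤ, ext (a, -i - 1 - 1 - q) (int (b, -q - 1) φ) S := rfl

theorem support_loopAction_subset {a : Fin 3} (ha : a ≠ 0) (f : ℤ → R) {φ : Fock R}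
    (hφ : Function.support φ ⊆ lowered) : Function.support (loopAction a 0 f φ) ⊆ lowered := by
  intro S hS
  by_contra hl
  refine hS ?_
  have h (p j : ℤ) : ext (a, p) (int (0, j) φ) S = 0 := by
    by_contra h
    exact hl (ext_int_ne_zero ha hφ h).1
  simp [loopAction_apply, h]

/-- The part of the action of `f(z) E_{a0}` that involves the powers `z^j` with `-k ≤ j < k`. -/
def truncLoop (a : Fin 3) (f : ℤ → R) (k : ℕ) : Module.End R (Fock R) :=
  ∑ j ∈ Finset.range k, ∑ s ∈ Finset.range k,
    f (j + s) • (ext (a, -1 - (s : ℤ)) * int (0, (j : ℤ)))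

theorem finsum_eq_sum_comp {ι M : Type*} [AddCommMonoid M] (F : ι → M) (s : Finset ℕ) (e : ℕ → ι)
    (he : Function.Injective e) (h : ∀ x, F x ≠ 0 → ∃ n ∈ s, e n = x) :
    ∑ᶠ x, F x = ∑ n ∈ s, F (e n) := by
  classical
  rw [finsum_eq_sum_of_support_subset F (s := s.image e), Finset.sum_image he.injOn]
  intro x hx
  simpa using h x hx

theorem loopAction_eq_truncLoop {a : Fin 3} (ha : a ≠ 0) (f : ℤ → R) {φ : Fock R}
    (hφ : Function.support φ ⊆ lowered) (k : ℕ) :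
    Set.EqOn (loopAction a 0 f φ) (truncLoop a f k φ) (window k) := by
  rintro S ⟨hS₀, hSa⟩
  have hg : ∀ p j : ℤ, ext (a, p) (int (0, j) φ) S ≠ 0 → (-k ≤ p ∧ p < 0) ∧ 0 ≤ j ∧ j < k := by
    intro p j h
    obtain ⟨-, h1, h2, h3, h4⟩ := ext_int_ne_zero ha hφ h
    refine ⟨⟨?_, h3⟩, h4, ?_⟩
    · by_contra hp
      exact hSa a ha p (by omega) h1
    · by_contra hj
      exact h2 (hS₀ j (by omega))
  have inner (i : ℤ) : ∑ᶠ q : ℤ, ext (a, -i - 1 - 1 - q) (int (0, -q - 1) φ) S =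
      ∑ j ∈ Finset.range k, ext (a, j - i - 1) (int (0, (j : ℤ)) φ) S := by
    rw [finsum_eq_sum_comp _ (Finset.range k) (fun j => -(j : ℤ) - 1)
      (fun x y h => by simpa using h)]
    · refine Finset.sum_congr rfl fun j _ => ?_
      rw [show -i - 1 - 1 - (-(j : ℤ) - 1) = j - i - 1 by ring,
        show -(-(j : ℤ) - 1) - 1 = j by ring]
    · intro q hq
      have := (hg _ _ hq).2
      exact ⟨(-q - 1).toNat, by simp; omega, by simp; omega⟩
  have outer (j : ℕ) (i : ℤ) (h : f i * ext (a, j - i - 1) (int (0, (j : ℤ)) φ) S ≠ 0) :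
      ∃ s ∈ Finset.range k, (j : ℤ) + (s : ℕ) = i := by
    have := (hg _ _ (right_ne_zero_of_mul h)).1
    exact ⟨(i - j).toNat, by simp; omega, by omega⟩
  simp only [loopAction_apply, inner, Finset.mul_sum]
  rw [finsum_sum_comm]
  · rw [truncLoop, LinearMap.sum_apply, Finset.sum_apply]
    refine Finset.sum_congr rfl fun j _ => ?_
    rw [finsum_eq_sum_comp _ (Finset.range k) (fun s => (j : ℤ) + (s : ℕ))
      (fun x y h => by simpa using h) (outer j), LinearMap.sum_apply, Finset.sum_apply]
    refine Finset.sum_congr rfl fun s _ => ?_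
    rw [show (j : ℤ) - (j + (s : ℕ)) - 1 = -1 - s by ring]
    rfl
  · intro j _
    refine ((Finset.range k).finite_toSet.image fun s : ℕ => (j : ℤ) + (s : ℕ)).subset ?_
    intro i hi
    exact outer j i hi

/-- Values of `e_b ∧ φ` on a window depend only on those of `φ`, unless `b = e₀ z^j`, `j ≥ k`. -/
theorem ext_eqOn {k : ℕ} {b : Mode} (hb : b.1 = 0 → b.2 < k) {φ ψ : Fock R}
    (h : Set.EqOn φ ψ (window k)) : Set.EqOn (ext b φ) (ext b ψ) (window k) := by
  intro S hS
  have hd : S.del b ∈ window k := by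
    refine ⟨fun j hj => ⟨hS.1 j hj, ?_⟩, fun a ha j hj h => hS.2 a ha j hj h.1⟩
    rintro rfl
    exact absurd hj (not_le.2 (hb rfl))
  simp only [ext_apply, h hd]

theorem int_eqOn {k : ℕ} {b : Mode} (hb : b.1 ≠ 0 → -(k : ℤ) ≤ b.2) {φ ψ : Fock R}
    (h : Set.EqOn φ ψ (window k)) : Set.EqOn (int b φ) (int b ψ) (window k) := by
  intro S hS
  have hd : S.add b ∈ window k := by
    refine ⟨fun j hj => Or.inr (hS.1 j hj), fun a ha j hj h => ?_⟩
    rcases h with rfl | h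
    · exact absurd hj (not_lt.2 (hb ha))
    · exact hS.2 a ha j hj h
  simp only [int_apply, h hd]

theorem truncLoop_eqOn {k : ℕ} {a : Fin 3} (ha : a ≠ 0) (f : ℤ → R) {φ ψ : Fock R}
    (h : Set.EqOn φ ψ (window k)) :
    Set.EqOn (truncLoop a f k φ) (truncLoop a f k ψ) (window k) := by
  intro S hS
  simp only [truncLoop, LinearMap.sum_apply, Finset.sum_apply]
  refine Finset.sum_congr rfl fun j hj => Finset.sum_congr rfl fun s _ => ?_
  have := ext_eqOn (b := (a, -1 - (s : ℤ))) (fun h => absurd h ha)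
    (int_eqOn (b := (0, (j : ℤ))) (fun h => absurd rfl h) h) hS
  simp only [LinearMap.smul_apply, Pi.smul_apply, Module.End.mul_apply, this]

theorem truncLoop_pow_eqOn {k : ℕ} {a : Fin 3} (ha : a ≠ 0) (f : ℤ → R) {φ ψ : Fock R}
    (h : Set.EqOn φ ψ (window k)) (n : ℕ) :
    Set.EqOn ((truncLoop a f k ^ n) φ) ((truncLoop a f k ^ n) ψ) (window k) := by
  induction n with
  | zero => simpa using h
  | succ n ih =>
    rw [pow_succ', Module.End.mul_apply, Module.End.mul_apply]
    exact truncLoop_eqOn ha f ih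

theorem support_iterate_loopAction_subset {a : Fin 3} (ha : a ≠ 0) (f : ℤ → R) {φ : Fock R}
    (hφ : Function.support φ ⊆ lowered) (n : ℕ) :
    Function.support ((loopAction a 0 f)^[n] φ) ⊆ lowered := by
  induction n with
  | zero => exact hφ
  | succ n ih =>
    rw [Function.iterate_succ_apply']
    exact support_loopAction_subset ha f ih

theorem iterate_loopAction_eqOn {a : Fin 3} (ha : a ≠ 0) (f : ℤ → R) {φ : Fock R}
    (hφ : Function.support φ ⊆ lowered) (k n : ℕ) :
    Set.EqOn ((loopAction a 0 f)^[n] φ) ((truncLoop a f k ^ n) φ) (window k) := by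
  induction n with
  | zero => exact fun _ _ => rfl
  | succ n ih =>
    rw [Function.iterate_succ_apply', pow_succ', Module.End.mul_apply]
    exact (loopAction_eq_truncLoop ha f (support_iterate_loopAction_subset ha f hφ n) k).trans
      (truncLoop_eqOn ha f ih)

/-! ### Exponentials of nilpotent operators -/

theorem ext_mul_self (b : Mode) : (ext b * ext b : Module.End R (Fock R)) = 0 := by
  refine LinearMap.ext fun φ => funext fun S => ?_
  simp [ext_apply, Wedge.mem_del]

theorem mul_mul_eq_of_anticomm {A : Type*} [Ring A] {b c d : A} (h : b * c = -(c * b))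
    (h' : b * d = -(d * b)) : b * (c * d) = c * d * b := by
  rw [← mul_assoc, h, neg_mul, mul_assoc, h', mul_neg, neg_neg, mul_assoc]

theorem mul_mul_eq_of_dual {A : Type*} [Ring A] {b c d : A} (h : b * c = 1 - c * b)
    (h' : b * d = -(d * b)) : b * (c * d) = c * d * b + d := by
  rw [← mul_assoc, h, sub_mul, one_mul, mul_assoc, h']
  noncomm_ring

theorem int_mul_ext_mul_int (b c d : Mode) :
    (int b * (ext c * int d) : Module.End R (Fock R)) =
      ext c * int d * int b + if b = c then int d else 0 := by
  split_ifs with h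
  · subst h
    exact mul_mul_eq_of_dual (int_mul_ext_self b) (int_mul_int b d)
  · rw [add_zero]
    exact mul_mul_eq_of_anticomm (int_mul_ext b c h) (int_mul_int b d)

theorem commute_ext_mul_int {b b' c c' : Mode} (h : b ≠ c') (h' : b' ≠ c) :
    Commute (ext b * int c : Module.End R (Fock R)) (ext b' * int c') := by
  have e : (ext b * (ext b' * int c') : Module.End R (Fock R)) = ext b' * int c' * ext b :=
    mul_mul_eq_of_anticomm (ext_mul_ext b b')
      (by rw [int_mul_ext c' b h.symm]; exact (neg_neg _).symm)
  have i : (int c * (ext b' * int c') : Module.End R (Fock R)) = ext b' * int c' * int c :=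
    mul_mul_eq_of_anticomm (int_mul_ext c b' h'.symm) (int_mul_int c c')
  exact Commute.mul_left e i

theorem isNilpotent_truncLoop {a : Fin 3} (ha : a ≠ 0) (f : ℤ → R) (k : ℕ) :
    IsNilpotent (truncLoop a f k) := by
  rw [truncLoop, ← Finset.sum_product']
  refine Commute.isNilpotent_sum (fun x _ => ⟨2, ?_⟩) fun x y _ _ => ?_
  · have h : (int (0, (x.1 : ℤ)) * ext (a, -1 - (x.2 : ℤ)) : Module.End R (Fock R)) =
        -(ext (a, -1 - (x.2 : ℤ)) * int (0, (x.1 : ℤ))) := int_mul_ext _ _ (by simp [ha.symm])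
    rw [smul_pow, pow_two (_ * _), mul_assoc, ← mul_assoc (int _), h]
    refine LinearMap.ext fun φ => ?_
    have h' := LinearMap.congr_fun (ext_mul_self (R := R) (a, -1 - (x.2 : ℤ)))
    simp only [Module.End.mul_apply, LinearMap.zero_apply] at h'
    simp [h']
  · exact ((commute_ext_mul_int (by simp [ha]) (by simp [ha])).smul_left _).smul_right _

theorem int_mul_truncLoop (b : Mode) (a : Fin 3) (f : ℤ → R) (k : ℕ) :
    int b * truncLoop a f k = truncLoop a f k * int b +
      ∑ j ∈ Finset.range k, ∑ s ∈ Finset.range k,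
        f (j + s) • if b = (a, -1 - (s : ℤ)) then int (0, (j : ℤ)) else 0 := by
  simp only [truncLoop, Finset.mul_sum, Finset.sum_mul, ← Finset.sum_add_distrib, mul_smul_comm,
    smul_mul_assoc, ← smul_add, int_mul_ext_mul_int]

theorem commute_int_truncLoop {b : Mode} {a : Fin 3} (h : b.1 ≠ a) (f : ℤ → R) (k : ℕ) :
    Commute (int b) (truncLoop a f k) := by
  rw [Commute, SemiconjBy, int_mul_truncLoop]
  have (s : ℕ) : b ≠ (a, -1 - (s : ℤ)) := fun h' => h (congrArg Prod.fst h')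
  simp [this]

theorem int_mul_truncLoop_self {a : Fin 3} {s k : ℕ} (hs : s < k) (f : ℤ → R) :
    int (a, -1 - (s : ℤ)) * truncLoop a f k = truncLoop a f k * int (a, -1 - (s : ℤ)) +
      ∑ j ∈ Finset.range k, f (j + s) • int (0, (j : ℤ)) := by
  rw [int_mul_truncLoop]
  congr 1
  refine Finset.sum_congr rfl fun j _ => ?_
  rw [Finset.sum_eq_single_of_mem s (Finset.mem_range.2 hs)]
  · simp
  · intro t _ ht
    simp [ht.symm]

section Exponential

variable [Algebra ℂ R]

/-- The sum of the first `N` terms of the exponential series. -/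
def truncExp (N : ℕ) (A : Module.End R (Fock R)) : Module.End R (Fock R) :=
  ∑ n ∈ Finset.range N, algebraMap ℂ R (n.factorial : ℂ)⁻¹ • A ^ n

theorem expAction_eqOn {a : Fin 3} (ha : a ≠ 0) (f : ℤ → R) {φ : Fock R}
    (hφ : Function.support φ ⊆ lowered) {k N : ℕ} (hN : truncLoop a f k ^ N = 0) :
    Set.EqOn (expAction a 0 f φ) (truncExp (N + 1) (truncLoop a f k) φ) (window k) := by
  intro S hS
  have h n := iterate_loopAction_eqOn ha f hφ k n hS
  simp only [expAction, h, truncExp, LinearMap.sum_apply, Finset.sum_apply]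
  rw [finsum_eq_sum_of_support_subset (s := Finset.range (N + 1))]
  · simp only [Algebra.smul_def]
    rfl
  · intro n hn
    by_contra hn'
    refine hn ?_
    simp only [Finset.coe_range, Set.mem_Iio, not_lt] at hn'
    simp [pow_eq_zero_of_le (by omega : N ≤ n) hN]

theorem support_expAction_subset {a : Fin 3} (ha : a ≠ 0) (f : ℤ → R) {φ : Fock R}
    (hφ : Function.support φ ⊆ lowered) : Function.support (expAction a 0 f φ) ⊆ lowered := by
  intro S hS
  by_contra hl
  refine hS ?_
  have h n : (loopAction a 0 f)^[n] φ S = 0 := by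
    by_contra h
    exact hl (support_iterate_loopAction_subset ha f hφ n h)
  simp [expAction, h]

theorem truncExp_eqOn {a : Fin 3} (ha : a ≠ 0) (f : ℤ → R) {φ ψ : Fock R} {k : ℕ}
    (h : Set.EqOn φ ψ (window k)) (N : ℕ) :
    Set.EqOn (truncExp N (truncLoop a f k) φ) (truncExp N (truncLoop a f k) ψ) (window k) := by
  intro S hS
  simp only [truncExp, LinearMap.sum_apply, Finset.sum_apply, LinearMap.smul_apply, Pi.smul_apply,
    truncLoop_pow_eqOn ha f h _ hS]

theorem expAction_zero (a b : Fin 3) (φ : Fock R) : expAction a b 0 φ = φ := by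
  funext S
  rw [expAction, finsum_eq_single _ 0]
  · simp
  · intro n hn
    obtain ⟨m, rfl⟩ := Nat.exists_eq_succ_of_ne_zero hn
    rw [Function.iterate_succ_apply']
    simp [loopAction]

theorem mul_truncExp {A B D : Module.End R (Fock R)} (h : D * A = A * D + B) (hB : Commute B A)
    {N : ℕ} (hN : A ^ N = 0) :
    D * truncExp (N + 1) A = truncExp (N + 1) A * D + truncExp (N + 1) A * B := by
  have hp (n : ℕ) : D * A ^ (n + 1) = A ^ (n + 1) * D + ((n : R) + 1) • (A ^ n * B) := by
    induction n with
    | zero => simpa using h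
    | succ n ih =>
      rw [pow_succ _ (n + 1), ← mul_assoc, ih, add_mul, mul_assoc, h, smul_mul_assoc, mul_assoc,
        hB.eq, mul_add, ← mul_assoc, ← mul_assoc, ← pow_succ, ← pow_succ, add_assoc]
      congr 1
      rw [Nat.cast_add, Nat.cast_one]
      module
  have hc (n : ℕ) : algebraMap ℂ R ((n + 1).factorial : ℂ)⁻¹ * ((n : R) + 1) =
      algebraMap ℂ R (n.factorial : ℂ)⁻¹ := by
    rw [show (n : R) + 1 = algebraMap ℂ R (n + 1) by simp, ← map_mul]
    congr 1
    have h1 : (n : ℂ) + 1 ≠ 0 := Nat.cast_add_one_ne_zero n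
    have h2 : (n.factorial : ℂ) ≠ 0 := Nat.cast_ne_zero.2 n.factorial_ne_zero
    rw [Nat.factorial_succ]
    push_cast
    field_simp
  have e1 : truncExp (N + 1) A * B = ∑ n ∈ Finset.range N,
      algebraMap ℂ R (n.factorial : ℂ)⁻¹ • (A ^ n * B) := by
    rw [truncExp, Finset.sum_range_succ, hN, smul_zero, add_zero, Finset.sum_mul]
    simp only [smul_mul_assoc]
  rw [e1, truncExp, Finset.mul_sum, Finset.sum_mul, Finset.sum_range_succ',
    Finset.sum_range_succ' (fun n => _ * D), add_right_comm, ← Finset.sum_add_distrib]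
  congr 1
  · refine Finset.sum_congr rfl fun n _ => ?_
    rw [mul_smul_comm, hp, smul_add, smul_smul, hc, smul_mul_assoc]
  · simp

theorem commute_truncExp {A D : Module.End R (Fock R)} (h : Commute D A) (N : ℕ) :
    Commute D (truncExp N A) :=
  Commute.sum_right _ _ _ fun _ _ => (h.pow_right _).smul_right _

theorem truncExp_apply_vac {a : Fin 3} (f : ℤ → R) (k N : ℕ) (φ : Fock R) :
    truncExp (N + 1) (truncLoop a f k) φ vac = φ vac := by
  have h (ψ : Fock R) : truncLoop a f k ψ vac = 0 := by
    simp only [truncLoop, LinearMap.sum_apply, Finset.sum_apply]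
    refine Finset.sum_eq_zero fun j _ => Finset.sum_eq_zero fun s _ => ?_
    have : ((a, -1 - (s : ℤ)) : Mode) ∉ vac.modes := show ¬ (0 : ℤ) ≤ -1 - (s : ℤ) by omega
    simp [ext_apply, this]
  rw [truncExp, Finset.sum_range_succ', LinearMap.add_apply, LinearMap.sum_apply, Pi.add_apply,
    Finset.sum_apply, Finset.sum_eq_zero]
  · simp
  · intro n _
    simp [pow_succ', h]

/-- The vector `g · v₀` restricted to a window is an exponential of finite sums, and on that
vector annihilation operators of components `1` and `2` act through those of component `0`. -/
theorem exists_eqOn_groupAction (C D : ℤ → R) (k : ℕ) : ∃ G : Fock R,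
    Set.EqOn (groupAction C D 0 (v₀ R)) G (window k) ∧ G vac = 1 ∧
    (∀ s < k, int (1, -1 - (s : ℤ)) G = ∑ j ∈ Finset.range k, C (j + s) • int (0, (j : ℤ)) G) ∧
    (∀ s < k, int (2, -1 - (s : ℤ)) G = ∑ j ∈ Finset.range k, D (j + s) • int (0, (j : ℤ)) G) := by
  have h1 : (1 : Fin 3) ≠ 0 := by decide
  have h2 : (2 : Fin 3) ≠ 0 := by decide
  obtain ⟨M, hM⟩ := isNilpotent_truncLoop h1 C k
  obtain ⟨N, hN⟩ := isNilpotent_truncLoop h2 D k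
  set X := truncExp (M + 1) (truncLoop 1 C k) with hX
  set Y := truncExp (N + 1) (truncLoop 2 D k) with hY
  have hv := support_v₀_subset_lowered (R := R)
  have cX (j : ℤ) : Commute (int (0, j)) X := commute_truncExp (commute_int_truncLoop h1.symm C k) _
  have cY (j : ℤ) : Commute (int (0, j)) Y := commute_truncExp (commute_int_truncLoop h2.symm D k) _
  have eX (j : ℤ) φ : int (0, j) (X φ) = X (int (0, j) φ) := LinearMap.congr_fun (cX j).eq φ
  have eY (j : ℤ) φ : int (0, j) (Y φ) = Y (int (0, j) φ) := LinearMap.congr_fun (cY j).eq φ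
  have hB (a : Fin 3) (ha : a ≠ 0) (f g : ℤ → R) (s : ℕ) :
      Commute (∑ j ∈ Finset.range k, g (j + s) • int (0, (j : ℤ))) (truncLoop a f k) :=
    Commute.sum_left _ _ _ fun j _ => (commute_int_truncLoop ha.symm f k).smul_left _
  refine ⟨X (Y (v₀ R)), ?_, ?_, fun s hs => ?_, fun s hs => ?_⟩
  · rw [groupAction, expAction_zero]
    exact (expAction_eqOn h1 C (support_expAction_subset h2 D hv) hM).trans
      (truncExp_eqOn h1 C (expAction_eqOn h2 D hv hN) _)
  · rw [hX, hY, truncExp_apply_vac, truncExp_apply_vac]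
    simp [v₀, wedge]
  · have h := LinearMap.congr_fun (mul_truncExp (int_mul_truncLoop_self hs C) (hB 1 h1 C C s) hM)
      (Y (v₀ R))
    have h' := LinearMap.congr_fun (commute_truncExp
      (commute_int_truncLoop (b := (1, -1 - (s : ℤ))) (a := 2) (by simp) D k) (N + 1)).eq (v₀ R)
    simp only [Module.End.mul_apply, LinearMap.add_apply, ← hX, ← hY] at h h'
    rw [h, h', int_v₀ _ (by dsimp only; omega)]
    simp [LinearMap.sum_apply, eX]
  · have h := LinearMap.congr_fun (mul_truncExp (int_mul_truncLoop_self hs D) (hB 2 h2 D D s) hN)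
      (v₀ R)
    have h' := LinearMap.congr_fun (commute_truncExp
      (commute_int_truncLoop (b := (2, -1 - (s : ℤ))) (a := 1) (by simp) C k) (M + 1)).eq
      (Y (v₀ R))
    simp only [Module.End.mul_apply, LinearMap.add_apply, ← hX, ← hY] at h h'
    rw [h', h, int_v₀ _ (by dsimp only; omega)]
    simp [LinearMap.sum_apply, eX, eY]

end Exponential

/-! ### Products of anticommuting elements -/

section Anticommuting

variable {A : Type*} [Ring A]

theorem mul_prod_of_anticomm {x : A} {l : List A} (h : ∀ y ∈ l, x * y = -(y * x)) :
    x * l.prod = (-1) ^ l.length * (l.prod * x) := by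
  induction l with
  | nil => simp
  | cons y l ih =>
    have hc := ((Commute.neg_one_left y).pow_left l.length).eq
    rw [List.prod_cons, ← mul_assoc, h y (by simp), neg_mul, mul_assoc,
      ih fun z hz => h z (by simp [hz]), ← mul_assoc, ← hc, List.length_cons, pow_succ']
    noncomm_ring

theorem prod_map_mul_of_anticomm {l : List (A × A)}
    (h : l.Pairwise fun p q => p.2 * q.1 = -(q.1 * p.2)) :
    (l.map fun p => p.1 * p.2).prod =
      (-1) ^ l.length.choose 2 * ((l.map Prod.fst).prod * (l.map Prod.snd).prod) := by
  induction l with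
  | nil => simp
  | cons p l ih =>
    rw [List.pairwise_cons] at h
    have hp : p.2 * (l.map Prod.fst).prod = (-1) ^ l.length * ((l.map Prod.fst).prod * p.2) := by
      rw [mul_prod_of_anticomm]
      · simp
      · simpa using fun y z hz => h.1 (y, z) hz
    have hc (n : ℕ) (y : A) : y * (-1) ^ n = (-1) ^ n * y :=
      ((Commute.neg_one_left y).pow_left n).eq.symm
    simp only [List.map_cons, List.prod_cons, List.length_cons, Nat.choose_succ_succ' _ 1,
      Nat.choose_one_right, Nat.reduceAdd, ih h.2, pow_add]
    generalize (l.map Prod.fst).prod = E at *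
    generalize (l.map Prod.snd).prod = I at *
    calc p.1 * p.2 * ((-1) ^ l.length.choose 2 * (E * I))
        = (-1) ^ l.length.choose 2 * (p.1 * (p.2 * E) * I) := by
          rw [← mul_assoc, hc]; noncomm_ring
      _ = (-1) ^ l.length.choose 2 * ((p.1 * (-1) ^ l.length) * (E * p.2 * I)) := by
          rw [hp]; noncomm_ring
      _ = _ := by
          rw [hc l.length p.1, hc (l.length.choose 2) ((-1) ^ l.length)]
          simp only [mul_assoc]

theorem prod_smul_eq_of_anticomm {V : Type*} [AddCommGroup V] [Module A V] (v : V)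
    {l : List (A × A)} (hv : ∀ p ∈ l, p.1 • v = p.2 • v)
    (h : l.Pairwise fun p q => p.1 * q.2 = -(q.2 * p.1) ∧ p.2 * q.2 = -(q.2 * p.2)) :
    (l.map Prod.fst).prod • v = (l.map Prod.snd).prod • v := by
  induction l with
  | nil => simp
  | cons p l ih =>
    rw [List.pairwise_cons] at h
    have h1 : p.1 * (l.map Prod.snd).prod = (-1) ^ l.length * ((l.map Prod.snd).prod * p.1) := by
      rw [mul_prod_of_anticomm]
      · simp
      · simpa using fun y z hz => (h.1 (z, y) hz).1
    have h2 : p.2 * (l.map Prod.snd).prod = (-1) ^ l.length * ((l.map Prod.snd).prod * p.2) := by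
      rw [mul_prod_of_anticomm]
      · simp
      · simpa using fun y z hz => (h.1 (z, y) hz).2
    rw [List.map_cons, List.map_cons, List.prod_cons, List.prod_cons, mul_smul,
      ih (fun q hq => hv q (by simp [hq])) h.2, ← mul_smul, h1, h2]
    simp only [mul_smul, hv p (by simp)]

/-- A product of `k` combinations of `k` anticommuting elements of square zero is a determinant
times the product of these elements. -/
theorem map_prod_ofFn_eq_det_mul {R : Type*} [CommRing R] [Algebra R A] {k : ℕ}
    (f : (Fin k → R) →ₗ[R] A) (hf : ∀ v, f v * f v = 0) (g : A →ₗ[R] R) (v : Fin k → Fin k → R) :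
    g (List.ofFn fun i => f (v i)).prod =
      (Matrix.of v).det * g (List.ofFn fun i => f (Pi.single i 1)).prod := by
  let F : (Fin k → R) [⋀^Fin k]→ₗ[R] R :=
    (g ∘ₗ (ExteriorAlgebra.lift R ⟨f, hf⟩).toLinearMap).compAlternatingMap
      (ExteriorAlgebra.ιMulti R k)
  have hF (w : Fin k → Fin k → R) : F w = g (List.ofFn fun i => f (w i)).prod := by
    simp only [F, LinearMap.compAlternatingMap_apply, LinearMap.comp_apply,
      ExteriorAlgebra.ιMulti_apply, AlgHom.toLinearMap_apply, map_list_prod, List.map_ofFn]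
    congr 3
    funext i
    simp
  have h := DFunLike.congr_fun (F.eq_smul_basis_det (Pi.basisFun R (Fin k))) v
  rw [AlternatingMap.smul_apply, Pi.basisFun_det, hF, hF, smul_eq_mul, mul_comm] at h
  rw [h]
  congr 2
  · congr 2
    funext i
    simp

end Anticommuting

theorem pairing_descProd (b c : ℕ → Mode) (n : ℕ) (φ ψ : Fock R) :
    pairing φ ((descProd (fun i => ext (b i) * int (c i)) n : Module.End R (Fock R)) ψ) =
      pairing ((List.ofFn fun i : Fin n => (ext (c i) * int (b i) : Module.End R (Fock R))).prod φ)
        ψ := by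
  induction n generalizing φ with
  | zero => simp [descProd]
  | succ n ih =>
    rw [descProd, Module.End.mul_apply, Module.End.mul_apply, pairing_ext, pairing_int, ih,
      List.ofFn_succ', List.concat_eq_append, List.prod_append]
    simp

theorem list_prod_eqOn {k : ℕ} {l : List (Module.End R (Fock R))}
    (h : ∀ A ∈ l, ∀ φ ψ : Fock R, Set.EqOn φ ψ (window k) → Set.EqOn (A φ) (A ψ) (window k))
    {φ ψ : Fock R} (hφ : Set.EqOn φ ψ (window k)) :
    Set.EqOn (l.prod φ) (l.prod ψ) (window k) := by
  induction l with
  | nil => simpa using hφ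
  | cons A l ih =>
    rw [List.prod_cons, Module.End.mul_apply, Module.End.mul_apply]
    exact h A (by simp) _ _ (ih fun B hB => h B (by simp [hB]))

/-- The interior product with `∑ j, v j e₀ z^j`. -/
def intComb (k : ℕ) : (Fin k → R) →ₗ[R] Module.End R (Fock R) :=
  Fintype.linearCombination R fun j : Fin k => int (0, (j.val : ℤ))

theorem intComb_apply {k : ℕ} (v : Fin k → R) :
    intComb k v = ∑ j : Fin k, v j • int (0, (j.val : ℤ)) := rfl

theorem int_mul_intComb (b : Mode) {k : ℕ} (v : Fin k → R) :
    int b * intComb k v = -(intComb k v * int b) := by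
  rw [intComb_apply, Finset.mul_sum, Finset.sum_mul, ← Finset.sum_neg_distrib]
  refine Finset.sum_congr rfl fun j _ => ?_
  rw [mul_smul_comm, smul_mul_assoc, int_mul_int, smul_neg]

theorem intComb_mul_intComb {k : ℕ} (v w : Fin k → R) :
    intComb k v * intComb k w = -(intComb k w * intComb k v) := by
  rw [intComb_apply v, Finset.mul_sum, Finset.sum_mul, ← Finset.sum_neg_distrib]
  refine Finset.sum_congr rfl fun j _ => ?_
  rw [mul_smul_comm, smul_mul_assoc, int_mul_intComb, smul_neg]

theorem intComb_mul_self [Algebra ℂ R] {k : ℕ} (v : Fin k → R) :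
    intComb k v * intComb k v = 0 := by
  refine LinearMap.ext fun φ => funext fun S => ?_
  have h := congrFun (LinearMap.congr_fun (intComb_mul_intComb v v) φ) S
  simp only [LinearMap.neg_apply, Pi.neg_apply, LinearMap.zero_apply, Pi.zero_apply] at h ⊢
  generalize (intComb k v * intComb k v) φ S = y at h
  have h2 : algebraMap ℂ R 2⁻¹ * algebraMap ℂ R 2 = 1 := by rw [← map_mul]; norm_num
  rw [← one_mul y, ← h2, map_ofNat, mul_assoc, two_mul]
  nth_rewrite 1 [h]
  simp

/-- The matrix of the coefficients with which annihilation operators of the components `1` and `2`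
act on `g · v₀`. -/
def coeffMatrix (C D : ℤ → R) (k ℓ : ℕ) : Matrix (Fin k) (Fin k) R :=
  Matrix.of fun i j => if j.val < ℓ then D (i.val + j.val) else C (i.val + (j.val - ℓ : ℕ))

theorem int_newMode_apply {C D : ℤ → R} {k : ℕ} {G : Fock R}
    (hC : ∀ s < k, int (1, -1 - (s : ℤ)) G =
      ∑ j ∈ Finset.range k, C (j + s) • int (0, (j : ℤ)) G)
    (hD : ∀ s < k, int (2, -1 - (s : ℤ)) G =
      ∑ j ∈ Finset.range k, D (j + s) • int (0, (j : ℤ)) G) (ℓ : ℕ) (i : Fin k) :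
    int (newMode ℓ i) G = intComb k (fun j => coeffMatrix C D k ℓ j i) G := by
  have hi := i.isLt
  simp only [intComb_apply, LinearMap.sum_apply, LinearMap.smul_apply, coeffMatrix, Matrix.of_apply]
  rw [newMode]
  split_ifs with h
  · rw [hD _ hi, Finset.sum_range]
  · rw [hC _ (by omega), Finset.sum_range]

theorem newMode_fst_ne (ℓ i : ℕ) : (newMode ℓ i).1 ≠ 0 := by
  rw [newMode]
  split_ifs <;> simp

theorem pairing_groupAction_descProd [Algebra ℂ R] (C D : ℤ → R) (k ℓ : ℕ) :
    pairing (groupAction C D 0 (v₀ R))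
      ((descProd (fun i => ext (newMode ℓ i) * int (0, (i : ℤ))) k : Module.End R (Fock R))
        (v₀ R)) = (coeffMatrix C D k ℓ).det := by
  obtain ⟨G, hG, hvac, hC, hD⟩ := exists_eqOn_groupAction C D k
  have hEq := list_prod_eqOn (k := k) (l := List.ofFn fun i : Fin k =>
    (ext (0, ((i : ℕ) : ℤ)) * int (newMode ℓ i) : Module.End R (Fock R))) (by
      simp only [List.mem_ofFn]
      rintro _ ⟨i, rfl⟩ φ ψ h
      refine ext_eqOn (fun _ => by simp) (int_eqOn (fun _ => ?_) h)
      have := i.isLt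
      rw [newMode]
      split_ifs <;> dsimp only <;> omega) hG (vac_mem_window k)
  rw [pairing_descProd (newMode ℓ) (fun i => (0, (i : ℤ))), pairing_v₀, hEq]
  let e (i : Fin k) : Module.End R (Fock R) := ext (0, ((i : ℕ) : ℤ))
  let E := (-1) ^ k.choose 2 * (List.ofFn e).prod
  have pairs (x : Fin k → Module.End R (Fock R)) (hx : ∀ i j, i < j → x i * e j = -(e j * x i)) :
      (List.ofFn fun i => e i * x i).prod = E * (List.ofFn x).prod := by
    have := prod_map_mul_of_anticomm (l := List.ofFn fun i => (e i, x i))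
      (List.pairwise_ofFn.2 hx)
    simp only [List.map_ofFn, List.length_ofFn] at this
    exact this.trans (mul_assoc _ _ _).symm
  have h1 := pairs (fun i => int (newMode ℓ i)) fun i j _ =>
    int_mul_ext _ _ fun h => newMode_fst_ne ℓ i (congrArg Prod.fst h)
  have h2 := pairs (fun i => int (0, ((i : ℕ) : ℤ))) fun i j hij =>
    int_mul_ext _ _ (by simpa [Fin.ext_iff] using hij.ne)
  have h3 := prod_smul_eq_of_anticomm G
    (l := List.ofFn fun i : Fin k => ((int (newMode ℓ i) : Module.End R (Fock R)),
      intComb k fun j => coeffMatrix C D k ℓ j i))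
    (by
      simp only [List.mem_ofFn]
      rintro _ ⟨i, rfl⟩
      exact int_newMode_apply hC hD ℓ i)
    (List.pairwise_ofFn.2 fun i j _ => ⟨int_mul_intComb _ _, intComb_mul_intComb _ _⟩)
  simp only [List.map_ofFn, Module.End.smul_def] at h3
  let g : Module.End R (Fock R) →ₗ[R] R :=
    (LinearMap.proj vac ∘ₗ LinearMap.applyₗ G) ∘ₗ LinearMap.mulLeft R E
  have h4 := map_prod_ofFn_eq_det_mul (intComb k) intComb_mul_self g
    (fun i j => coeffMatrix C D k ℓ j i)
  have hb (i : Fin k) : intComb k (Pi.single i (1 : R)) = int (0, ((i : ℕ) : ℤ)) := by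
    rw [intComb_apply, Finset.sum_eq_single_of_mem i (Finset.mem_univ _)]
    · simp
    · intro j _ hj
      simp [hj]
  have h5 : ∀ l : List (Fin k), (l.map fun i : Fin k =>
      (ext (0, ((i : ℕ) : ℤ)) * int (0, ((i : ℕ) : ℤ)) : Module.End R (Fock R))).prod G vac = 1 := by
    intro l
    induction l with
    | nil => simpa using hvac
    | cons i l ih =>
      have : ((0, ((i : ℕ) : ℤ)) : Mode) ∈ vac.modes := show (0 : ℤ) ≤ _ by simp
      rw [List.map_cons, List.prod_cons, Module.End.mul_apply, Module.End.mul_apply,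
        ext_int_apply, if_pos this, ih]
  calc _ = (E * (List.ofFn fun i : Fin k => int (newMode ℓ i)).prod : Module.End R (Fock R)) G vac :=
        congrFun (LinearMap.congr_fun h1 G) vac
    _ = g (List.ofFn fun i => intComb k fun j => coeffMatrix C D k ℓ j i).prod :=
        congrFun (congrArg E h3) vac
    _ = _ := by
        rw [h4]
        simp only [hb]
        have h6 : g (List.ofFn fun i : Fin k => int (0, ((i : ℕ) : ℤ))).prod = 1 := by
          refine (congrFun (LinearMap.congr_fun h2 G) vac).symm.trans ?_
          rw [List.ofFn_eq_map]
          exact h5 _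
        rw [h6, mul_one]
        exact Matrix.det_transpose _

theorem tau_eq_det [Algebra ℂ R] (c d e : ℤ → R) (α β : ℤ) (hE : shiftSeries e β = 0) (k ℓ : ℕ)
    (h : ℓ ≤ k) : tau c d e α β k ℓ =
      (-1) ^ (ℓ * (ℓ + 1) / 2) * (momentMatrix c d α β k ℓ).det := by
  rw [tau, hE, zpow_natCast, zpow_natCast, T₁_pow_T₂_pow_v₀_eq_descProd k ℓ h, pairing_zsmul,
    pairing_groupAction_descProd, zsmul_eq_mul]
  congr 1
  · simp
  · congr 1
    ext i j
    simp only [coeffMatrix, momentMatrix, Matrix.of_apply, shiftSeries]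
    split_ifs with hj
    · congr 1
      ring
    · rw [Nat.cast_sub (not_lt.1 hj)]
      congr 1
      ring

/-! ### Vanishing -/

/-- The wedges without modes `e₁ z^j`, `j < y`. -/
def emptyBelow (y : ℤ) : Set Wedge := {S | ∀ j < y, ((1, j) : Mode) ∉ S.modes}

theorem Wedge.mem_translate (a : Fin 3) (n : ℤ) (S : Wedge) (b : Fin 3) (j : ℤ) :
    (b, j) ∈ (S.translate a n).modes ↔ (b, if b = a then j + n else j) ∈ S.modes := Iff.rfl

theorem support_Q_subset (a : Fin 3) {φ : Fock R} {y : ℤ}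
    (h : Function.support φ ⊆ emptyBelow y) :
    Function.support (Q R a φ) ⊆ emptyBelow (y - shift a 1) := by
  intro S hS j hj hm
  refine h (right_ne_zero_of_mul hS) (j + shift a 1) (by omega) ?_
  rw [Wedge.mem_translate]
  rw [shift] at *
  split_ifs at * <;> simpa using hm

theorem support_Q_inv_subset (a : Fin 3) {φ : Fock R} {y : ℤ}
    (h : Function.support φ ⊆ emptyBelow y) :
    Function.support ((Q R a)⁻¹ φ) ⊆ emptyBelow (y + shift a 1) := by
  intro S hS j hj hm
  have hS' : φ (S.translate a 1) ≠ 0 :=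
    right_ne_zero_of_mul (a := ((S.translationSign a : ℤ) : R)) hS
  refine h hS' (j - shift a 1) (by omega) ?_
  rw [Wedge.mem_translate]
  rw [shift] at *
  split_ifs at * <;> simpa using hm

theorem support_zpow_subset {T : Fock R ≃ₗ[R] Fock R} {r : ℤ}
    (hT : ∀ φ y, Function.support φ ⊆ emptyBelow y → Function.support (T φ) ⊆ emptyBelow (y + r))
    (hT' : ∀ φ y, Function.support φ ⊆ emptyBelow y →
      Function.support (T⁻¹ φ) ⊆ emptyBelow (y - r)) (n : ℤ) {φ : Fock R} {y : ℤ}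
    (h : Function.support φ ⊆ emptyBelow y) :
    Function.support ((T ^ n) φ) ⊆ emptyBelow (y + n * r) := by
  induction n generalizing φ y with
  | zero => simpa using h
  | succ n ih =>
    rw [zpow_add_one, LinearEquiv.mul_apply]
    have := ih (hT φ y h)
    rwa [show y + r + n * r = y + (n + 1) * r by ring] at this
  | pred n ih =>
    rw [zpow_sub_one, LinearEquiv.mul_apply]
    have := ih (hT' φ y h)
    rwa [show y - r + -n * r = y + (-n - 1) * r by ring] at this

theorem support_Q_mul_Q_inv_subset (a b : Fin 3) {φ : Fock R} {y : ℤ}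
    (h : Function.support φ ⊆ emptyBelow y) :
    Function.support ((Q R a * (Q R b)⁻¹) φ) ⊆ emptyBelow (y + (shift b 1 - shift a 1)) := by
  rw [LinearEquiv.mul_apply, ← add_sub_assoc]
  exact support_Q_subset a (support_Q_inv_subset b h)

theorem support_zpow_Q_mul_Q_inv_subset (a b : Fin 3) (n : ℤ) {φ : Fock R} {y : ℤ}
    (h : Function.support φ ⊆ emptyBelow y) :
    Function.support (((Q R a * (Q R b)⁻¹) ^ n) φ) ⊆
      emptyBelow (y + n * (shift b 1 - shift a 1)) := by
  refine support_zpow_subset (fun φ y h => support_Q_mul_Q_inv_subset a b h) (fun φ y h => ?_) n h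
  rw [mul_inv_rev, inv_inv, sub_eq_add_neg, neg_sub]
  exact support_Q_mul_Q_inv_subset b a h

theorem tau_eq_zero [Algebra ℂ R] (c d e : ℤ → R) (α β : ℤ) (hE : shiftSeries e β = 0) (k ℓ : ℤ)
    (h : k < ℓ) : tau c d e α β k ℓ = 0 := by
  have h0 : Function.support (v₀ R) ⊆ emptyBelow 0 := fun S hS j hj hm =>
    absurd hm (by
      by_cases hS' : S = vac
      · subst hS'
        exact not_le.2 hj
      · simp [v₀, wedge, hS'] at hS)
  have hT := support_zpow_Q_mul_Q_inv_subset (R := R) 1 0 k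
    (support_zpow_Q_mul_Q_inv_subset (R := R) 2 1 ℓ h0)
  have hg := support_expAction_subset (a := 1) (by decide) (shiftSeries c (α - β))
    (support_expAction_subset (a := 2) (by decide) (shiftSeries d α)
      (support_v₀_subset_lowered (R := R)))
  rw [tau, hE, groupAction, expAction_zero, pairing]
  refine (finsum_congr fun S => ?_).trans finsum_zero
  by_contra hS
  refine hT (right_ne_zero_of_mul hS) 0 ?_ ((hg (left_ne_zero_of_mul hS)).2 1 (by decide) 0 le_rfl)
  simp [shift]
  omega

/-! ### The bordered determinant -/

theorem det_eq_mul_det_of_last_column {k : ℕ} (B : Matrix (Fin (k + 1)) (Fin (k + 1)) R) (w : R)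
    (h : ∀ i : Fin k, B i.castSucc (Fin.last k) = w * B i.succ (Fin.last k)) :
    B.det = B (Fin.last k) (Fin.last k) *
      (Matrix.of fun i j : Fin k => B i.castSucc j.castSucc - w * B i.succ j.castSucc).det := by
  let B' : Matrix (Fin (k + 1)) (Fin (k + 1)) R := Matrix.of fun i j =>
    Fin.cases (B (Fin.last k) j.rev) (fun i => B i.rev.castSucc j.rev - w * B i.rev.succ j.rev) i
  have h1 : B.det = B'.det := by
    rw [← Matrix.det_submatrix_equiv_self Fin.revPerm B]
    refine Matrix.det_eq_of_forall_row_eq_smul_add_pred (fun _ => w) (fun j => ?_) fun i j => ?_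
    · simp [B']
    · simp [B', Fin.rev_succ, Fin.rev_castSucc]
  rw [h1, Matrix.det_succ_column_zero, Fin.sum_univ_succ, Finset.sum_eq_zero, add_zero,
    ← Matrix.det_submatrix_equiv_self Fin.revPerm (Matrix.of fun i j : Fin k => _)]
  · have : B'.submatrix (Fin.succAbove 0) Fin.succ = (Matrix.of fun i j : Fin k =>
        B i.castSucc j.castSucc - w * B i.succ j.castSucc).submatrix Fin.revPerm Fin.revPerm := by
      ext i j
      simp [B', Fin.rev_succ]
    rw [this]
    simp [B']
  · intro i _
    simp [B', h]

theorem zPow_mul (m n : ℤ) : zPow m * zPow n = zPow (m + n) := by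
  rw [zPow, zPow, zPow, ← map_mul, ← LaurentPolynomial.T_add]

theorem zPow_pow (n : ℕ) : zPow 1 ^ n = zPow n := by
  rw [zPow, zPow, ← map_pow, LaurentPolynomial.T_pow, mul_one]

theorem shiftPlus_X_self (a : Fin 3) (i : ℤ) :
    shiftPlus a (MvPolynomial.X (a, i)) =
      MvPolynomial.X (a, i) - zPow (-1) * MvPolynomial.X (a, i + 1) := by
  simp [shiftPlus]

theorem shiftPlus_X_ne {a b : Fin 3} (h : b ≠ a) (i : ℤ) :
    shiftPlus a (MvPolynomial.X (b, i)) = MvPolynomial.X (b, i) := by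
  simp [shiftPlus, h]

theorem shiftPlus_zPow (a : Fin 3) (n : ℤ) : shiftPlus a (zPow n) = zPow n :=
  MvPolynomial.aeval_C _ _

theorem zPow_mul_shiftPlus_det_momentMatrix (α β : ℤ) (k ℓ : ℕ) (h : ℓ ≤ k) :
    zPow k * shiftPlus 0 (shiftPlus 1 (momentMatrix cVar dVar α β k ℓ).det) =
      (borderedMatrix cVar dVar (zPow 1) α β k ℓ).det := by
  rw [det_eq_mul_det_of_last_column _ (zPow (-1)), AlgHom.map_det, AlgHom.map_det]
  · congr 1
    · simp [borderedMatrix, not_lt.2 h, zPow_pow]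
    · congr 1
      ext1 i j
      have hj := j.isLt
      simp only [AlgHom.mapMatrix_apply, Matrix.map_apply, momentMatrix, borderedMatrix,
        Matrix.of_apply, Fin.val_castSucc, Fin.val_succ]
      by_cases hl : j.val < ℓ
      · simp only [hl, if_true, dVar, shiftPlus_X_self, map_sub, map_mul, shiftPlus_zPow,
          shiftPlus_X_ne (show (1 : Fin 3) ≠ 0 by decide)]
        push_cast
        ring_nf
      · simp only [hl, hj, if_true, if_false, cVar, shiftPlus_X_self,
          shiftPlus_X_ne (show (0 : Fin 3) ≠ 1 by decide)]
        push_cast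
        ring_nf
  · intro i
    simp only [borderedMatrix, Matrix.of_apply, Fin.val_last, not_lt.2 h, lt_irrefl, if_false,
      Fin.val_castSucc, Fin.val_succ, zPow_pow, zPow_mul]
    congr 1
    push_cast
    ring

end FermionicFock

end

open FermionicFock in
theorem mainTheorem4 {R : Type*} [CommRing R] [Algebra ℂ R] (c d e : ℤ → R) (α β : ℤ)
    (hE : shiftSeries e β = 0) :
    (∀ k ℓ : ℤ, k < ℓ → tau c d e α β k ℓ = 0) ∧
    (∀ k ℓ : ℕ, ℓ ≤ k →
      tau c d e α β k ℓ = (-1) ^ (ℓ * (ℓ + 1) / 2) * (momentMatrix c d α β k ℓ).det) ∧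
    (∀ e' : ℤ → FormalRing, shiftSeries e' β = 0 → ∀ k ℓ : ℕ, ℓ ≤ k →
      zPow k * shiftPlus 0 (shiftPlus 1 (tau cVar dVar e' α β k ℓ)) =
        (-1) ^ (ℓ * (ℓ + 1) / 2) *
          (borderedMatrix cVar dVar (zPow 1) α β k ℓ).det) := by
  refine ⟨tau_eq_zero c d e α β hE, tau_eq_det c d e α β hE, fun e' he' k ℓ h => ?_⟩
  rw [tau_eq_det _ _ e' α β he' k ℓ h, ← zPow_mul_shiftPlus_det_momentMatrix α β k ℓ h]
  simp only [map_mul, map_pow, map_neg, map_one]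
  exact mul_left_comm _ _ _
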